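/- Let $M$ be a smooth manifold (Hausdorff, $\sigma$-compact) of dimension $2n$ and let $\mathcal T=T_M\otimes_{\mathbb R}\mathbb C[[t]]$ be the sheaf of formal complex vector fields on $M$. Let $(M,\omega,\mathcal P)$ be a formal polarized symplectic manifold: $\omega=\omega_0+t\omega_1+\cdots$ is a closed formal complex 2-form with $\omega_0$ nondegenerate, and $\mathcal P\subset\mathcal T$ is a subsheaf of $C^\infty_M[[t]]$-modules such that, locally on $M$, there are formal complex coordinates $x_1,\dots,x_n,y_1,\dots,y_n$ with $\omega=\sum_i dy_i\wedge dx_i$ and $\mathcal P=(dx_1,\dots,dx_n)^\perp$. Let $\mathcal P^\perp\subset\mathcal T^*$ be the sheaf of formal 1-forms that vanish on $\mathcal P$, and let $d\mathcal P^\perp$ be its image sheaf under the exterior derivative, so that $\Gamma(M,d\mathcal P^\perp)$ consists of the formal 2-forms on $M$ which near each point are of the form $d\eta$ with $\eta$ a section of $\mathcal P^\perp$. A connection $\nabla$ on $\mathcal T$ is called $\mathcal P$-symplectic if it is torsion-free, preserves $\omega$, preserves $\mathcal P$ (i.e. $\nabla_X\mathcal P\subset\mathcal P$ for all $X\in\mathcal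 T$), and is flat on $\mathcal P$ along $\mathcal P$ (i.e. $(\nabla_X\nabla_Y-\nabla_Y\nabla_X-\nabla_{[X,Y]})Z=0$ for all $X,Y,Z\in\mathcal P$). Then: (1) there exists a $\mathcal P$-symplectic connection on $M$; (2) for every $\mathcal P$-symplectic connection $\nabla$, the trace $\mathrm{tr}(\nabla^2|_{\mathcal P})$ of its curvature restricted to $\mathcal P$ is a formal 2-form that belongs to $\Gamma(M,d\mathcal P^\perp)$; (3) if $\nabla$ and $\nabla_1$ are $\mathcal P$-symplectic connections, then $\mathrm{tr}(\nabla_1^2|_{\mathcal P})-\mathrm{tr}(\nabla^2|_{\mathcal P})\in d\,\Gamma(M,\mathcal P^\perp)$, so the class of $\mathrm{tr}(\nabla^2|_{\mathcal P})$ in $\Gamma(M,d\mathcal P^\perp)/d\,\Gamma(M,\mathcal P^\perp)$ does not depend on $\nabla$. The same holds for ordinary polarized symplectic manifolds, i.e. without the formal parameter, with $\mathbb C$ in place of $\mathbb C[[t]]$. -/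

import Mathlib

open scoped Manifold Topology

noncomputable section

namespace FormalPSM

/-! ### Calculus over an algebra of functions

`K` is the ring of constants and `F` the algebra of functions; vector fields are the `K`-derivations
of `F` with the commutator bracket, and tensors are the `F`-multilinear maps on vector fields. -/

section Calculus

variable (K F : Type*) [CommRing K] [CommRing F] [Algebra K F]

/-- Differential 1-forms. -/
abbrev OneForm : Type _ := Derivation K F F →ₗ[F] F

/-- Covariant 2-tensors; the differential 2-forms are those `β` with `β.IsAlt`. -/
abbrev TwoTensor : Type _ := LinearMap.BilinForm F (Derivation K F F)

/-- Connections (covariant derivatives) on the tangent bundle, `toFun X Y = ∇_X Y`. -/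
structure Connection where
  toFun : Derivation K F F → Derivation K F F → Derivation K F F
  add_left : ∀ X X' Y, toFun (X + X') Y = toFun X Y + toFun X' Y
  smul_left : ∀ (f : F) X Y, toFun (f • X) Y = f • toFun X Y
  add_right : ∀ X Y Y', toFun X (Y + Y') = toFun X Y + toFun X Y'
  smul_right : ∀ (c : K) X Y, toFun X (c • Y) = c • toFun X Y
  leibniz : ∀ (f : F) X Y, toFun X (f • Y) = X f • Y + f • toFun X Y

variable {K F}

theorem smul_lie_eq (f : F) (X Y : Derivation K F F) :
    ⁅f • X, Y⁆ = f • ⁅X, Y⁆ - (Y f) • X := by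
  ext g
  simp only [Derivation.commutator_apply, Derivation.smul_apply, Derivation.sub_apply, smul_eq_mul,
    Derivation.leibniz]
  ring

theorem lie_smul_eq (f : F) (X Y : Derivation K F F) :
    ⁅X, f • Y⁆ = f • ⁅X, Y⁆ + (X f) • Y := by
  ext g
  simp only [Derivation.commutator_apply, Derivation.smul_apply, Derivation.add_apply, smul_eq_mul,
    Derivation.leibniz]
  ring

/-- The exterior derivative of a 1-form, `dη(X, Y) = X(η(Y)) - Y(η(X)) - η([X, Y])`. -/
def extDerivOne (η : OneForm K F) : TwoTensor K F :=
  LinearMap.mk₂ F (fun X Y => X (η Y) - Y (η X) - η ⁅X, Y⁆)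
    (by intro X X' Y; simp only [add_lie, map_add, Derivation.add_apply]; ring)
    (by
      intro f X Y
      simp only [smul_lie_eq, map_sub, map_smul, Derivation.smul_apply, smul_eq_mul,
        Derivation.leibniz]
      ring)
    (by intro X Y Y'; simp only [lie_add, map_add, Derivation.add_apply]; ring)
    (by
      intro f X Y
      simp only [lie_smul_eq, map_add, map_smul, Derivation.smul_apply, smul_eq_mul,
        Derivation.leibniz]
      ring)

/-- A 2-form is closed: its exterior derivative, evaluated on any three fields, vanishes. -/
def IsClosedForm (β : TwoTensor K F) : Prop :=
  ∀ X Y Z : Derivation K F F,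
    X (β Y Z) - Y (β X Z) + Z (β X Y) - β ⁅X, Y⁆ Z + β ⁅X, Z⁆ Y - β ⁅Y, Z⁆ X = 0

/-- The curvature operator `R(X, Y) = ∇_X ∇_Y - ∇_Y ∇_X - ∇_{[X, Y]}`. -/
def Connection.curvature (D : Connection K F) (X Y : Derivation K F F) :
    Derivation K F F →ₗ[F] Derivation K F F where
  toFun Z := D.toFun X (D.toFun Y Z) - D.toFun Y (D.toFun X Z) - D.toFun ⁅X, Y⁆ Z
  map_add' := by
    intro Z Z'
    simp only [D.add_right]
    abel
  map_smul' := by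
    intro f Z
    simp only [D.leibniz, D.add_right, RingHom.id_apply, Derivation.commutator_apply]
    module

/-- The connection preserves the distribution with module of sections `P`. -/
def Connection.Preserves (D : Connection K F) (P : Submodule F (Derivation K F F)) : Prop :=
  ∀ X Y : Derivation K F F, Y ∈ P → D.toFun X Y ∈ P

/-- `P`-symplectic connections. -/
structure IsPSymplectic (ω : TwoTensor K F) (P : Submodule F (Derivation K F F))
    (D : Connection K F) : Prop where
  torsionFree : ∀ X Y : Derivation K F F, D.toFun X Y - D.toFun Y X = ⁅X, Y⁆
  symplectic : ∀ X Y Z : Derivation K F F, X (ω Y Z) = ω (D.toFun X Y) Z + ω Y (D.toFun X Z)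
  preserves : D.Preserves P
  flat : ∀ X ∈ P, ∀ Y ∈ P, ∀ Z ∈ P, D.curvature X Y Z = 0

/-- The endomorphism that the curvature operator `R(X, Y)` induces on the sections of `P`. -/
def Connection.curvatureOn (D : Connection K F) {P : Submodule F (Derivation K F F)}
    (h : D.Preserves P) (X Y : Derivation K F F) : P →ₗ[F] P :=
  (D.curvature X Y).restrict (fun Z hZ =>
    P.sub_mem (P.sub_mem (h X _ (h Y Z hZ)) (h Y _ (h X Z hZ))) (h ⁅X, Y⁆ Z hZ))

/-- For `I` the ideal of functions vanishing at a point, the fibre at this point of the bundle with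
module of sections `P`: the sections modulo those that vanish at the point. -/
abbrev Fibre (P : Submodule F (Derivation K F F)) (I : Ideal F) : Type _ :=
  P ⧸ (I • (⊤ : Submodule F P))

/-- The trace over `K` of the endomorphism that the curvature operator `R(X, Y)` induces on the
fibre of `P` at the point with ideal `I`. -/
def Connection.fibreCurvatureTrace (D : Connection K F) {P : Submodule F (Derivation K F F)}
    (h : D.Preserves P) (X Y : Derivation K F F) (I : Ideal F) : K :=
  LinearMap.trace K (Fibre P I)
    (LinearMap.restrictScalars K
      (Submodule.mapQ (I • (⊤ : Submodule F P)) (I • (⊤ : Submodule F P)) (D.curvatureOn h X Y)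
        (Submodule.smul_top_le_comap_smul_top I (D.curvatureOn h X Y))))

/-- `Γ(M, P^⊥)`: the global 1-forms that vanish on `P`. -/
def perp (P : Submodule F (Derivation K F F)) : Set (OneForm K F) :=
  {η | ∀ X ∈ P, η X = 0}

/-- `d Γ(M, P^⊥)`. -/
def exactPerp (P : Submodule F (Derivation K F F)) : Set (TwoTensor K F) :=
  extDerivOne '' perp P

end Calculus

/-! ### Formal geometry on a manifold -/

/-- The ring of formal scalars. The type `σ` is the set of formal parameters: when it is empty this
is `ℂ` (ordinary, undeformed geometry), when it has exactly one element `t` this is `ℂ[[t]]`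
(indeed `PowerSeries ℂ` is by definition `MvPowerSeries Unit ℂ`). -/
abbrev Scalars (σ : Type*) : Type _ := MvPowerSeries σ ℂ

section

variable (n : ℕ) (M σ : Type*) [TopologicalSpace M]
  [ChartedSpace (EuclideanSpace ℝ (Fin (2 * n))) M]

/-- The formal complex-valued smooth functions `C^∞(M)[[t]]` on a smooth manifold `M` of dimension
`2n`. The series `∑ t^k f_k` is regarded as the function `p ↦ ∑ t^k f_k(p)` with values in the
formal scalars; all its coefficients `f_k` are required to be smooth. -/
def formalFun : Subalgebra (Scalars σ) (M → Scalars σ) where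
  carrier := {f | ∀ k : σ →₀ ℕ,
    ContMDiff (𝓡 (2 * n)) 𝓘(ℝ, ℂ) (⊤ : ℕ∞) (fun p => MvPowerSeries.coeff k (f p))}
  mul_mem' := by
    classical
    intro f g hf hg k
    simp only [Pi.mul_apply, MvPowerSeries.coeff_mul]
    exact ContMDiff.sum fun i _ => (contDiff_mul (𝕜 := ℝ) (𝔸 := ℂ)).contMDiff.comp
      ((hf i.1).prodMk_space (hg i.2))
  add_mem' := by
    intro f g hf hg k
    simp only [Pi.add_apply, map_add]
    exact (hf k).add (hg k)
  algebraMap_mem' := by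
    intro r k
    exact contMDiff_const

/-- The algebra of formal smooth functions on `M`. -/
def Fn : Type _ := ↥(formalFun n M σ)

instance : CommRing (Fn n M σ) := inferInstanceAs (CommRing ↥(formalFun n M σ))

instance : Algebra (Scalars σ) (Fn n M σ) :=
  inferInstanceAs (Algebra (Scalars σ) ↥(formalFun n M σ))

/-- Formal complex vector fields on `M`, i.e. the global sections of the complexified tangent bundle
with coefficients in formal power series, as derivations of the algebra of formal functions. -/
abbrev VF : Type _ := Derivation (Scalars σ) (Fn n M σ) (Fn n M σ)

end

section

variable {n : ℕ} {M σ : Type*} [TopologicalSpace M]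
  [ChartedSpace (EuclideanSpace ℝ (Fin (2 * n))) M]

/-- The value of a formal function at a point. -/
def valueAt (p : M) (f : Fn n M σ) : Scalars σ := f.1 p

/-- The value at a point of the leading term `f₀` of `f = f₀ + t f₁ + ⋯`. -/
def leadingAt (p : M) (f : Fn n M σ) : ℂ := MvPowerSeries.constantCoeff (valueAt p f)

/-- The ideal of the formal functions that vanish at `p`. -/
def vanishingIdeal (p : M) : Ideal (Fn n M σ) where
  carrier := {f | valueAt p f = 0}
  add_mem' := by
    intro f g hf hg
    have h : valueAt p (f + g) = valueAt p f + valueAt p g := rfl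
    simp only [Set.mem_ofPred_eq] at hf hg ⊢
    rw [h, hf, hg, add_zero]
  zero_mem' := rfl
  smul_mem' := by
    intro c f hf
    have h : valueAt p (c • f) = valueAt p c * valueAt p f := rfl
    simp only [Set.mem_ofPred_eq] at hf ⊢
    rw [h, hf, mul_zero]

/-- The leading term `ω₀` of `ω = ω₀ + t ω₁ + ⋯` is nondegenerate at each point `p`: if
`ω₀(X₀, ·)` vanishes at `p` then the leading term `X₀` of `X` vanishes at `p`. -/
def LeadingNondegenerate (ω : TwoTensor (Scalars σ) (Fn n M σ)) : Prop :=
  ∀ (p : M) (X : VF n M σ),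
    (∀ Y : VF n M σ, leadingAt p (ω X Y) = 0) → ∀ f : Fn n M σ, leadingAt p (X f) = 0

/-- The differential at `p` of the leading term of a formal function, a complex covector. -/
def leadingDifferential (f : Fn n M σ) (p : M) : EuclideanSpace ℝ (Fin (2 * n)) →L[ℝ] ℂ :=
  mfderiv (𝓡 (2 * n)) 𝓘(ℝ, ℂ) (fun q : M => leadingAt q f) p

/-- `x i, y i` (together `2n = dim M` formal functions) are Darboux coordinates for `ω` on `U`: they
are coordinates, i.e. at each point of `U` the differentials of their leading terms are linearly
independent over `ℂ`, and `ω = ∑ dyᵢ ∧ dxᵢ` on `U`.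

Here and below, a formal function or form that is defined near a point is represented by a globally
defined one with the same restriction to a smaller neighbourhood (multiply by a cut-off). -/
def IsDarbouxOn (ω : TwoTensor (Scalars σ) (Fn n M σ)) (x y : Fin n → Fn n M σ) (U : Set M) :
    Prop :=
  (∀ q ∈ U, LinearIndependent ℂ
      (fun i : Fin n ⊕ Fin n => leadingDifferential (Sum.elim x y i) q)) ∧
    ∀ X Y : VF n M σ, ∀ q ∈ U,
      valueAt q (ω X Y) = valueAt q (∑ i, (X (y i) * Y (x i) - X (x i) * Y (y i)))

/-- The germ of the vector field `X` at `p` belongs to the stalk at `p` of the subsheaf of the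
tangent sheaf whose module of global sections is `P`. -/
def GermMem (P : Submodule (Fn n M σ) (VF n M σ)) (p : M) (X : VF n M σ) : Prop :=
  ∃ X' ∈ P, ∀ᶠ q in 𝓝 p, ∀ f : Fn n M σ, valueAt q (X f) = valueAt q (X' f)

/-- `(M, ω, P)` is a polarized symplectic manifold (formal, if there is a formal parameter). The
distribution is given by the module `P` of its global sections, which determines it.
Locally there are Darboux coordinates `x i, y i` for `ω` with `P = (dx i)^⊥`. -/
structure IsPolarizedSymplectic (ω : TwoTensor (Scalars σ) (Fn n M σ))
    (P : Submodule (Fn n M σ) (VF n M σ)) : Prop where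
  alt : ω.IsAlt
  closed : IsClosedForm ω
  nondegenerate : LeadingNondegenerate ω
  sheaf : ∀ X : VF n M σ, (∀ p : M, GermMem P p X) → X ∈ P
  polarization : ∀ p : M, ∃ U : Set M, IsOpen U ∧ p ∈ U ∧ ∃ x y : Fin n → Fn n M σ,
    IsDarbouxOn ω x y U ∧
      ∀ q ∈ U, ∀ X : VF n M σ, GermMem P q X ↔ ∀ᶠ r in 𝓝 q, ∀ i, valueAt r (X (x i)) = 0

/-- `β` is the 2-form `tr(∇²|_P)`: at each point its value on `X, Y` is the trace of the
endomorphism that the curvature operator `R(X, Y)` induces on the fibre of `P`. -/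
def IsCurvatureTrace (D : Connection (Scalars σ) (Fn n M σ))
    {P : Submodule (Fn n M σ) (VF n M σ)} (h : D.Preserves P)
    (β : TwoTensor (Scalars σ) (Fn n M σ)) : Prop :=
  ∀ (X Y : VF n M σ) (p : M),
    valueAt p (β X Y) = D.fibreCurvatureTrace h X Y (vanishingIdeal p)

/-- `Γ(M, d P^⊥)`: the global sections of the image sheaf of `d` on `P^⊥`, i.e. the 2-forms that
near each point are the exterior derivative of a section of `P^⊥`. -/
def sectionsDPerp (P : Submodule (Fn n M σ) (VF n M σ)) :
    Set (TwoTensor (Scalars σ) (Fn n M σ)) :=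
  {β | ∀ p : M, ∃ η ∈ perp P, ∀ᶠ q in 𝓝 p, ∀ X Y : VF n M σ,
    valueAt q (β X Y) = valueAt q (extDerivOne η X Y)}

end

end FormalPSM

end

/-! Near each point, adapted Darboux coordinates give a frame `ex i`, `ey i` of coordinate fields in
which the `ey i` span the polarization P. Everything rests on one computation in such a frame
(`DarbouxFrame.connection_ey_veq_zero`): if ∇ is torsion-free and preserves ω and P, then ∇_X ey_i =
0 for X in P. Indeed ω(ey_i, ex_j) is constant, so ω(∇_X ey_i, ex_j) = -ω(ey_i, ∇_X ex_j), and ∇_X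
ex_j = ∇_{ex_j} X + [X, ex_j] has no x-components.

Existence: the connection for which a Darboux frame is parallel is torsion-free and preserves ω and
P. These conditions are affine, so they survive averaging by a partition of unity. Flatness along P
is quadratic and does not, but it follows from the computation above
(`DarbouxFrame.curvature_veq_zero`).

Trace: let θ = ∑ dy_i(∇ ey_i) be the trace of the connection matrix on P. Then tr(∇²|_P) = dθ,
because the quadratic part tr(A ∧ A) vanishes, and θ kills P by the same computation; so the trace
is locally in d P^⊥. For two connections, the difference of the forms θ is the trace of the tensor
∇₁ - ∇ on P. It does not depend on the frame, hence is a global section of P^⊥ whose differential is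
the difference of the curvature traces.

Vector fields here are algebraic derivations, so the frames must be constructed: derivations are
local by cut-offs, Hadamard's lemma applied to each coefficient expresses them through chart
coordinates, and inverting a Jacobian passes to the Darboux coordinates (`exists_chart_frame`,
`exists_dual_frame`). -/

open scoped Manifold Topology

noncomputable section
namespace FormalPSM

/-! ### Formal functions: evaluation, cut-offs, locality, inverses. -/

section
variable {n : ℕ} {M σ : Type*} [TopologicalSpace M]
  [ChartedSpace (EuclideanSpace ℝ (Fin (2 * n))) M]

/-- Evaluation of formal functions at a point. -/
def ev (p : M) : Fn n M σ →ₐ[Scalars σ] Scalars σ :=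
  (Pi.evalAlgHom (Scalars σ) (fun _ : M => Scalars σ) p).comp (formalFun n M σ).val

theorem valueAt_eq_ev (p : M) (f : Fn n M σ) : valueAt p f = ev p f := rfl

theorem Fn.ext_ev {f g : Fn n M σ} (h : ∀ p, ev p f = ev p g) : f = g :=
  Subtype.ext (funext h)

theorem ev_algebraMap (p : M) (c : Scalars σ) : ev p (algebraMap _ (Fn n M σ) c) = c := by
  simp

theorem contMDiff_coeff_ev (f : Fn n M σ) (k : σ →₀ ℕ) :
    ContMDiff (𝓡 (2 * n)) 𝓘(ℝ, ℂ) (⊤ : ℕ∞) (fun p => MvPowerSeries.coeff k (ev p f)) :=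
  f.2 k

theorem exists_ev_eq (g : M → Scalars σ) (h : ∀ k : σ →₀ ℕ,
    ContMDiff (𝓡 (2 * n)) 𝓘(ℝ, ℂ) (⊤ : ℕ∞) (fun p => MvPowerSeries.coeff k (g p))) :
    ∃ f : Fn n M σ, ∀ p, ev p f = g p :=
  ⟨⟨g, h⟩, fun _ => rfl⟩

variable [T2Space M] [IsManifold (𝓡 (2 * n)) (⊤ : ℕ∞) M]

/-- A formal function defined near `p` agrees near `p` with a global one of small support. -/
theorem exists_extension {U : Set M} (hU : IsOpen U) {p : M} (hp : p ∈ U) (g : M → Scalars σ)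
    (hg : ∀ k : σ →₀ ℕ, ∀ q ∈ U, ContMDiffAt (𝓡 (2 * n)) 𝓘(ℝ, ℂ) (⊤ : ℕ∞)
      (fun p => MvPowerSeries.coeff k (g p)) q) :
    ∃ f : Fn n M σ, (∀ᶠ q in 𝓝 p, ev q f = g q) ∧ ∀ q ∉ U, ∀ᶠ r in 𝓝 q, ev r f = 0 := by
  obtain ⟨χ, hχ, -⟩ :=
    (SmoothBumpFunction.nhds_basis_support (I := 𝓡 (2 * n)) (hU.mem_nhds hp)).mem_iff.1
      (hU.mem_nhds hp)
  obtain ⟨f, hf⟩ := exists_ev_eq (n := n)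
    (fun q => MvPowerSeries.C (χ q : ℂ) * g q) (by
      intro k
      simp only [MvPowerSeries.coeff_C_mul]
      apply contMDiff_of_tsupport
      intro q hq
      have hq' : q ∈ tsupport χ := by
        refine closure_mono ?_ hq
        intro r hr h0
        apply hr
        simp [h0]
      have h1 : ContMDiffAt (𝓡 (2 * n)) 𝓘(ℝ, ℂ) (⊤ : ℕ∞) (fun q => χ q • (1 : ℂ)) q :=
        (χ.contMDiffAt).smul contMDiffAt_const
      have := (contDiff_mul (𝕜 := ℝ) (𝔸 := ℂ) (n := (⊤ : ℕ∞))).contMDiff.contMDiffAt.comp q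
        (h1.prodMk_space (hg k q (hχ hq')))
      refine this.congr_of_eventuallyEq (Filter.Eventually.of_forall fun r => ?_)
      simp)
  refine ⟨f, ?_, ?_⟩
  · filter_upwards [χ.eventuallyEq_one] with q hq
    rw [hf, hq]
    simp
  · intro q hq
    have : (tsupport χ)ᶜ ∈ 𝓝 q :=
      (isClosed_tsupport χ).isOpen_compl.mem_nhds (fun h => hq (hχ h))
    filter_upwards [this] with r hr
    rw [hf, image_eq_zero_of_notMem_tsupport hr]
    simp

theorem exists_cutoff {U : Set M} (hU : IsOpen U) {p : M} (hp : p ∈ U) :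
    ∃ f : Fn n M σ, (∀ᶠ q in 𝓝 p, ev q f = 1) ∧ ∀ q ∉ U, ∀ᶠ r in 𝓝 q, ev r f = 0 :=
  exists_extension hU hp (fun _ => 1) fun _ _ _ => contMDiffAt_const

/-- Derivations are local. -/
theorem ev_derivation_congr (X : VF n M σ) {f g : Fn n M σ} {p : M}
    (h : ∀ᶠ q in 𝓝 p, ev q f = ev q g) : ev p (X f) = ev p (X g) := by
  obtain ⟨U, hU, hUo, hp⟩ := eventually_nhds_iff.1 h
  obtain ⟨χ, h1, h0⟩ := exists_cutoff (σ := σ) (n := n) hUo hp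
  -- Applying X to this identity and evaluating at `p`, where χ = 1 and f - g = 0, leaves X(f -
  -- g)(p) = 0.
  have hz : χ * (f - g) = 0 := by
    refine Fn.ext_ev fun q => ?_
    by_cases hq : q ∈ U
    · simp [hU q hq]
    · simp [(h0 q hq).self_of_nhds]
  have := congrArg (fun φ => ev p (X φ)) hz
  simpa [Derivation.leibniz, h1.self_of_nhds, h.self_of_nhds, sub_eq_zero] using this

/-- Two vector fields have the same value at `p`. -/
def VEq (p : M) (X Y : VF n M σ) : Prop := ∀ f : Fn n M σ, ev p (X f) = ev p (Y f)

/-- Connections are local in the differentiated field. -/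
theorem Connection.veq_right (D : Connection (Scalars σ) (Fn n M σ)) (X : VF n M σ)
    {Y Y' : VF n M σ} {p : M} (h : ∀ᶠ q in 𝓝 p, VEq q Y Y') :
    VEq p (D.toFun X Y) (D.toFun X Y') := by
  obtain ⟨U, hU, hUo, hp⟩ := eventually_nhds_iff.1 h
  obtain ⟨χ, h1, h0⟩ := exists_cutoff (σ := σ) (n := n) hUo hp
  have hz : χ • Y = χ • Y' := by
    refine Derivation.ext fun f => Fn.ext_ev fun q => ?_
    by_cases hq : q ∈ U
    · simp [hU q hq f]
    · simp [(h0 q hq).self_of_nhds]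
  intro f
  have := congrArg (fun Z => ev p (D.toFun X Z f)) hz
  simpa [D.leibniz, h1.self_of_nhds, h.self_of_nhds f] using this

/-- A formal function with nonvanishing leading term is invertible near the point. -/
theorem exists_local_inverse {p : M} (f : Fn n M σ)
    (hf : MvPowerSeries.constantCoeff (ev p f) ≠ 0) :
    ∃ g : Fn n M σ, ∀ᶠ q in 𝓝 p, ev q f * ev q g = 1 := by
  classical
  have hcont : Continuous fun q : M => MvPowerSeries.constantCoeff (ev q f) :=
    (contMDiff_coeff_ev f 0).continuous
  have hUo : IsOpen {q : M | MvPowerSeries.constantCoeff (ev q f) ≠ 0} :=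
    isOpen_ne_fun hcont continuous_const
  -- The coefficients of the inverse series satisfy a recursion whose only division is by the
  -- constant term, so they are smooth by well-founded induction on the exponent.
  obtain ⟨g, hg, -⟩ := exists_extension (n := n) hUo hf (fun q => (ev q f)⁻¹) (by
    intro k q hq
    induction k using WellFoundedLT.induction with
    | ind k ih =>
      rw [show (fun q : M => MvPowerSeries.coeff k (ev q f)⁻¹) = _ from
        funext fun q => MvPowerSeries.coeff_inv k (ev q f)]
      have hinv : ContMDiffAt (𝓡 (2 * n)) 𝓘(ℝ, ℂ) (⊤ : ℕ∞)
          (fun q : M => (MvPowerSeries.constantCoeff (ev q f))⁻¹) q :=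
        (contDiffAt_inv ℝ (n := (⊤ : ℕ∞)) hq).contMDiffAt.comp q
          (contMDiff_coeff_ev f 0).contMDiffAt
      have hmul : ∀ {a b : M → ℂ}, ContMDiffAt (𝓡 (2 * n)) 𝓘(ℝ, ℂ) (⊤ : ℕ∞) a q →
          ContMDiffAt (𝓡 (2 * n)) 𝓘(ℝ, ℂ) (⊤ : ℕ∞) b q →
          ContMDiffAt (𝓡 (2 * n)) 𝓘(ℝ, ℂ) (⊤ : ℕ∞) (fun r => a r * b r) q := fun ha hb =>
        (contDiff_mul (𝕜 := ℝ) (𝔸 := ℂ) (n := (⊤ : ℕ∞))).contMDiff.contMDiffAt.comp q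
          (ha.prodMk_space hb)
      by_cases hk : k = 0
      · simpa [hk] using hinv
      · simp only [hk, if_false]
        refine hmul hinv.neg (ContMDiffAt.sum fun i _ => ?_)
        by_cases hi : i.2 < k
        · simp only [hi, if_true]
          exact hmul (contMDiff_coeff_ev f i.1).contMDiffAt (ih i.2 hi)
        · simp only [hi, if_false]
          exact contMDiffAt_const)
  refine ⟨g, ?_⟩
  filter_upwards [hg, hUo.mem_nhds hf] with q h1 h2
  rw [h1, MvPowerSeries.mul_inv_cancel _ h2]

end

/-! ### Hadamard's lemma on a normed space. -/

open MeasureTheory in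
/-- Hadamard's lemma. -/
theorem exists_hadamard_of_contDiff {E F : Type*} [NormedAddCommGroup E] [NormedSpace ℝ E]
    [NormedAddCommGroup F] [NormedSpace ℝ F] [CompleteSpace F]
    {f : E → F} (hf : ContDiff ℝ (⊤ : ℕ∞) f) (a : E) :
    ∃ G : E → E →L[ℝ] F, ContDiff ℝ (⊤ : ℕ∞) G ∧ (∀ v, f v - f a = G v (v - a)) ∧
      G a = fderiv ℝ f a := by
  have hdf : ContDiff ℝ (⊤ : ℕ∞) (fderiv ℝ f) := hf.fderiv_right (by simp)
  refine ⟨fun v => ∫ s in (0 : ℝ)..1, fderiv ℝ f (a + s • (v - a)), ?_, ?_, ?_⟩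
  -- Smoothness in `v` is taken from smoothness of convolutions with a parameter: the integral is
  -- the convolution at 0 of the indicator of (0, 1] with `g v`. The factor η supplies compact
  -- support and equals 1 at all the points -s that matter.
  · let η : ContDiffBump (0 : ℝ) := ⟨1, 2, by norm_num, by norm_num⟩
    let g : E → ℝ → E →L[ℝ] F := fun v s => η s • fderiv ℝ f (a - s • (v - a))
    have hg : ContDiff ℝ (⊤ : ℕ∞) (Function.uncurry g) := by
      refine (η.contDiff.comp contDiff_snd).smul (hdf.comp ?_)
      exact contDiff_const.sub (contDiff_snd.smul (contDiff_fst.sub contDiff_const))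
    have key := contDiffOn_convolution_right_with_param (μ := volume)
      (f := Set.indicator (Set.Ioc (0 : ℝ) 1) (fun _ => (1 : ℝ)))
      (ContinuousLinearMap.lsmul ℝ ℝ : ℝ →L[ℝ] (E →L[ℝ] F) →L[ℝ] (E →L[ℝ] F))
      (g := g) (s := Set.univ) (k := tsupport η) isOpen_univ η.hasCompactSupport
      (fun p x _ hx => by simp [g, image_eq_zero_of_notMem_tsupport hx])
      ((locallyIntegrable_const (1 : ℝ)).indicator measurableSet_Ioc)
      hg.contDiffOn
    rw [Set.univ_prod_univ, contDiffOn_univ] at key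
    have key' := key.comp ((contDiff_id (E := E)).prodMk (contDiff_const (c := (0 : ℝ))))
    convert key' using 1
    funext v
    simp only [Function.comp_apply, id, MeasureTheory.convolution,
      ContinuousLinearMap.lsmul_apply, zero_sub]
    rw [intervalIntegral.integral_of_le zero_le_one, ← integral_indicator measurableSet_Ioc]
    congr 1
    funext s
    by_cases hs : s ∈ Set.Ioc (0 : ℝ) 1
    · have : η (-s) = 1 := η.one_of_mem_closedBall (by
        simpa [η, abs_le] using ⟨by linarith [hs.1], hs.2⟩)
      simp [hs, g, this]
    · simp [hs]
  · intro v
    have h1 : ∀ s : ℝ, HasDerivAt (fun s : ℝ => f (a + s • (v - a)))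
        (fderiv ℝ f (a + s • (v - a)) (v - a)) s := by
      intro s
      have h2 : HasDerivAt (fun s : ℝ => a + s • (v - a)) (v - a) s := by
        simpa using ((hasDerivAt_id s).smul_const (v - a)).const_add a
      exact ((hf.differentiable (by simp)) _).hasFDerivAt.comp_hasDerivAt s h2
    have hc : Continuous fun s : ℝ => fderiv ℝ f (a + s • (v - a)) :=
      hdf.continuous.comp (by fun_prop)
    have h3 := intervalIntegral.integral_eq_sub_of_hasDerivAt (a := (0 : ℝ)) (b := 1)
      (fun s _ => h1 s) ((hc.clm_apply continuous_const).intervalIntegrable 0 1)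
    have h4 := ContinuousLinearMap.intervalIntegral_apply (hc.intervalIntegrable (μ := volume) 0 1)
      (v - a)
    rw [h3] at h4
    simpa using h4.symm
  · simp

/-! ### Derivatives in a chart and the expansion of derivations in chart coordinates. -/

section
variable {n : ℕ} {M σ : Type*} [TopologicalSpace M]
  [ChartedSpace (EuclideanSpace ℝ (Fin (2 * n))) M]

/-- Here the cut-off is fixed in advance, in contrast to `exists_extension`. One χ therefore serves
every f in `exists_chart_derivation`, which is what makes the cut-off derivative additive and
Leibniz. -/
theorem exists_mul_extension {U : Set M} (χ : Fn n M σ)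
    (hχ : ∀ q ∉ U, ∀ᶠ r in 𝓝 q, ev r χ = 0) (g : M → Scalars σ)
    (hg : ∀ k : σ →₀ ℕ, ∀ q ∈ U, ContMDiffAt (𝓡 (2 * n)) 𝓘(ℝ, ℂ) (⊤ : ℕ∞)
      (fun p => MvPowerSeries.coeff k (g p)) q) :
    ∃ f : Fn n M σ, ∀ q, ev q f = ev q χ * g q := by
  classical
  refine exists_ev_eq _ fun k q => ?_
  by_cases hq : q ∈ U
  · simp only [MvPowerSeries.coeff_mul]
    exact ContMDiffAt.sum fun i _ =>
      (contDiff_mul (𝕜 := ℝ) (𝔸 := ℂ) (n := (⊤ : ℕ∞))).contMDiff.contMDiffAt.comp q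
        ((contMDiff_coeff_ev χ i.1).contMDiffAt.prodMk_space (hg i.2 q hq))
  · refine (contMDiffAt_const (c := (0 : ℂ))).congr_of_eventuallyEq ?_
    filter_upwards [hχ q hq] with r hr
    simp [hr]

/-- The formal scalar with given coefficients. -/
def ofCoeff (a : (σ →₀ ℕ) → ℂ) : Scalars σ := a

@[simp] theorem coeff_ofCoeff (a : (σ →₀ ℕ) → ℂ) (k : σ →₀ ℕ) :
    MvPowerSeries.coeff k (ofCoeff a) = a k := rfl

/-- The `k`-th coefficient of a formal function read in the chart at `c`. -/
def chartCoeff (c : M) (f : Fn n M σ) (k : σ →₀ ℕ) (w : EuclideanSpace ℝ (Fin (2 * n))) : ℂ :=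
  MvPowerSeries.coeff k (ev ((extChartAt (𝓡 (2 * n)) c).symm w) f)

/-- The derivative of a formal function in the direction `v` of the chart at `c`. -/
def chartDeriv (c : M) (v : EuclideanSpace ℝ (Fin (2 * n))) (f : Fn n M σ) (q : M) : Scalars σ :=
  fun k => fderiv ℝ (chartCoeff c f k) (extChartAt (𝓡 (2 * n)) c q) v

theorem coeff_chartDeriv (c : M) (v : EuclideanSpace ℝ (Fin (2 * n))) (f : Fn n M σ) (q : M)
    (k : σ →₀ ℕ) : MvPowerSeries.coeff k (chartDeriv c v f q) =
      fderiv ℝ (chartCoeff c f k) (extChartAt (𝓡 (2 * n)) c q) v := rfl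

theorem chartDeriv_algebraMap (c : M) (v : EuclideanSpace ℝ (Fin (2 * n))) (a : Scalars σ)
    (q : M) : chartDeriv c v (algebraMap _ (Fn n M σ) a) q = 0 := by
  ext k
  have h : chartCoeff c (algebraMap _ (Fn n M σ) a) k = fun _ => MvPowerSeries.coeff k a := by
    funext w
    rw [chartCoeff, ev_algebraMap]
  rw [coeff_chartDeriv, h]
  simp

theorem leadingDifferential_eq (f : Fn n M σ) (c : M) (v : EuclideanSpace ℝ (Fin (2 * n))) :
    leadingDifferential f c v = MvPowerSeries.constantCoeff (chartDeriv c v f c) := by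
  have hd : MDifferentiableAt (𝓡 (2 * n)) 𝓘(ℝ, ℂ) (fun q : M => leadingAt q f) c :=
    ((contMDiff_coeff_ev f 0).contMDiffAt).mdifferentiableAt (by simp)
  rw [← MvPowerSeries.coeff_zero_eq_constantCoeff_apply, coeff_chartDeriv, leadingDifferential,
    hd.mfderiv]
  simp only [modelWithCornersSelf_coe, Set.range_id, fderivWithin_univ]
  rfl

variable [IsManifold (𝓡 (2 * n)) (⊤ : ℕ∞) M]

theorem contDiffOn_chartCoeff (c : M) (f : Fn n M σ) (k : σ →₀ ℕ) :
    ContDiffOn ℝ (⊤ : ℕ∞) (chartCoeff c f k) (extChartAt (𝓡 (2 * n)) c).target :=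
  ((contMDiff_coeff_ev f k).comp_contMDiffOn
    (contMDiffOn_extChartAt_symm (n := (⊤ : ℕ∞)) c)).contDiffOn

theorem contDiffAt_chartCoeff {c q : M} (hq : q ∈ (extChartAt (𝓡 (2 * n)) c).source)
    (f : Fn n M σ) (k : σ →₀ ℕ) :
    ContDiffAt ℝ (⊤ : ℕ∞) (chartCoeff c f k) (extChartAt (𝓡 (2 * n)) c q) :=
  (contDiffOn_chartCoeff c f k).contDiffAt
    ((isOpen_extChartAt_target c).mem_nhds ((extChartAt (𝓡 (2 * n)) c).map_source hq))

theorem contMDiffAt_chartDeriv {c q : M} (hq : q ∈ (extChartAt (𝓡 (2 * n)) c).source)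
    (v : EuclideanSpace ℝ (Fin (2 * n))) (f : Fn n M σ) (k : σ →₀ ℕ) :
    ContMDiffAt (𝓡 (2 * n)) 𝓘(ℝ, ℂ) (⊤ : ℕ∞)
      (fun p => MvPowerSeries.coeff k (chartDeriv c v f p)) q := by
  have h : ContDiffAt ℝ (⊤ : ℕ∞) (fun w => fderiv ℝ (chartCoeff c f k) w v)
      (extChartAt (𝓡 (2 * n)) c q) :=
    ((contDiffAt_chartCoeff hq f k).fderiv_right (by simp)).clm_apply contDiffAt_const
  exact h.contMDiffAt.comp q (contMDiffAt_extChartAt' (by simpa using hq))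

theorem chartDeriv_add {c q : M} (hq : q ∈ (extChartAt (𝓡 (2 * n)) c).source)
    (v : EuclideanSpace ℝ (Fin (2 * n))) (f g : Fn n M σ) :
    chartDeriv c v (f + g) q = chartDeriv c v f q + chartDeriv c v g q := by
  ext k
  have h : chartCoeff c (f + g) k = fun w => chartCoeff c f k w + chartCoeff c g k w := by
    funext w
    simp [chartCoeff]
  rw [map_add, coeff_chartDeriv, coeff_chartDeriv, coeff_chartDeriv, h,
    fderiv_fun_add ((contDiffAt_chartCoeff hq f k).differentiableAt (by simp))
      ((contDiffAt_chartCoeff hq g k).differentiableAt (by simp))]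
  rfl

theorem chartDeriv_mul {c q : M} (hq : q ∈ (extChartAt (𝓡 (2 * n)) c).source)
    (v : EuclideanSpace ℝ (Fin (2 * n))) (f g : Fn n M σ) :
    chartDeriv c v (f * g) q = ev q f * chartDeriv c v g q + ev q g * chartDeriv c v f q := by
  classical
  ext k
  have h : chartCoeff c (f * g) k = fun w => ∑ i ∈ Finset.HasAntidiagonal.antidiagonal k,
      chartCoeff c f i.1 w * chartCoeff c g i.2 w := by
    funext w
    simp [chartCoeff, MvPowerSeries.coeff_mul]
  have hf := fun i => (contDiffAt_chartCoeff hq f i).differentiableAt (by simp)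
  have hg := fun i => (contDiffAt_chartCoeff hq g i).differentiableAt (by simp)
  have hd : ∀ i : (σ →₀ ℕ) × (σ →₀ ℕ),
      fderiv ℝ (fun w => chartCoeff c f i.1 w * chartCoeff c g i.2 w)
        (extChartAt (𝓡 (2 * n)) c q) v =
      MvPowerSeries.coeff i.1 (ev q f) * MvPowerSeries.coeff i.2 (chartDeriv c v g q) +
      MvPowerSeries.coeff i.2 (ev q g) * MvPowerSeries.coeff i.1 (chartDeriv c v f q) := by
    intro i
    have hv : ∀ (f : Fn n M σ) k, chartCoeff c f k (extChartAt (𝓡 (2 * n)) c q) =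
        MvPowerSeries.coeff k (ev q f) := fun f k => by
      rw [chartCoeff, (extChartAt (𝓡 (2 * n)) c).left_inv hq]
    rw [fderiv_fun_mul (hf i.1) (hg i.2), hv, hv]
    rfl
  rw [coeff_chartDeriv, h, fderiv_fun_sum fun i _ => (hf i.1).mul (hg i.2), map_add,
    MvPowerSeries.coeff_mul, mul_comm (ev q g), MvPowerSeries.coeff_mul,
    sum_apply, Finset.sum_congr rfl fun i _ => hd i, Finset.sum_add_distrib]
  congr 1
  exact Finset.sum_congr rfl fun i _ => mul_comm _ _

/-- The coordinate vector fields of a chart, cut off outside the chart. -/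
theorem exists_chart_derivation (c : M) (χ : Fn n M σ)
    (hχ : ∀ q ∉ (extChartAt (𝓡 (2 * n)) c).source, ∀ᶠ r in 𝓝 q, ev r χ = 0)
    (v : EuclideanSpace ℝ (Fin (2 * n))) :
    ∃ δ : VF n M σ, ∀ f q, ev q (δ f) = ev q χ * chartDeriv c v f q := by
  choose d hd using fun f : Fn n M σ => exists_mul_extension χ hχ
    (chartDeriv c v f) (fun k q hq => contMDiffAt_chartDeriv hq v f k)
  have hout : ∀ q ∉ (extChartAt (𝓡 (2 * n)) c).source, ev q χ = 0 :=
    fun q hq => (hχ q hq).self_of_nhds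
  have hadd : ∀ f g, d (f + g) = d f + d g := by
    intro f g
    refine Fn.ext_ev fun q => ?_
    by_cases hq : q ∈ (extChartAt (𝓡 (2 * n)) c).source
    · rw [map_add, hd, hd, hd, chartDeriv_add hq, mul_add]
    · rw [map_add, hd, hd, hd, hout q hq]; simp
  have hmul : ∀ f g, d (f * g) = f • d g + g • d f := by
    intro f g
    refine Fn.ext_ev fun q => ?_
    by_cases hq : q ∈ (extChartAt (𝓡 (2 * n)) c).source
    · rw [map_add, smul_eq_mul, smul_eq_mul, map_mul, map_mul, hd, hd, hd, chartDeriv_mul hq]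
      ring
    · rw [map_add, smul_eq_mul, smul_eq_mul, map_mul, map_mul, hd, hd, hd, hout q hq]; simp
  have hsmul : ∀ (a : Scalars σ) f, d (a • f) = a • d f := by
    intro a f
    have h0 : d (algebraMap _ _ a) = 0 := by
      refine Fn.ext_ev fun q => ?_
      rw [hd, chartDeriv_algebraMap]; simp
    rw [Algebra.smul_def a f, hmul, h0, smul_zero, add_zero, algebraMap_smul]
  exact ⟨Derivation.mk' ⟨⟨d, hadd⟩, hsmul⟩ hmul, fun f q => hd f q⟩

variable [T2Space M]

/-- Hadamard's lemma is applied to each coefficient separately and the results are assembled into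
formal functions. Only the finite sum over coordinates remains, so a derivation can be applied to it
without any continuity in the formal parameters. -/
theorem exists_local_hadamard {c q : M} (hq : q ∈ (extChartAt (𝓡 (2 * n)) c).source)
    (f : Fn n M σ) :
    ∃ h : Fin (2 * n) → Fn n M σ,
      (∀ᶠ r in 𝓝 q, ev r f = ev q f + ∑ b, MvPowerSeries.C
        ((extChartAt (𝓡 (2 * n)) c r b - extChartAt (𝓡 (2 * n)) c q b : ℝ) : ℂ) * ev r (h b)) ∧
      ∀ b, ev q (h b) = chartDeriv c (EuclideanSpace.single b 1) f q := by
  set φ := extChartAt (𝓡 (2 * n)) c with hφ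
  set a := φ q with ha
  have haT : a ∈ φ.target := φ.map_source hq
  obtain ⟨ε, hε, hball⟩ := Metric.isOpen_iff.1 (isOpen_extChartAt_target c) a haT
  -- The outer radius ε/2 < ε keeps the closed support inside the chart target, so η times a
  -- coefficient is smooth on the whole space.
  let η : ContDiffBump a := ⟨ε / 3, ε / 2, by positivity, by linarith⟩
  have hη : tsupport η ⊆ φ.target := by
    rw [η.tsupport_eq]
    exact (Metric.closedBall_subset_ball (by simp only [η]; linarith)).trans hball
  have hF : ∀ k, ContDiff ℝ (⊤ : ℕ∞) fun w => η w • chartCoeff c f k w := by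
    intro k
    rw [contDiff_iff_contDiffAt]
    intro w
    by_cases hw : w ∈ tsupport η
    · exact η.contDiff.contDiffAt.smul ((contDiffOn_chartCoeff c f k).contDiffAt
        ((isOpen_extChartAt_target c).mem_nhds (hη hw)))
    · refine (contDiffAt_const (c := (0 : ℂ))).congr_of_eventuallyEq ?_
      filter_upwards [(isClosed_tsupport η).isOpen_compl.mem_nhds hw] with z hz
      rw [image_eq_zero_of_notMem_tsupport hz, zero_smul]
  choose G hG hG1 hG2 using fun k => exists_hadamard_of_contDiff (hF k) a
  have hη1 : ∀ᶠ w in 𝓝 a, η w = 1 := η.eventuallyEq_one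
  choose h hh _ using fun b : Fin (2 * n) =>
    exists_extension (n := n) (σ := σ) (isOpen_extChartAt_source c) hq
      (fun r => ofCoeff fun k => G k (φ r) (EuclideanSpace.single b 1)) (by
        intro k r hr
        have : ContDiffAt ℝ (⊤ : ℕ∞) (fun w => G k w (EuclideanSpace.single b 1)) (φ r) :=
          (hG k).contDiffAt.clm_apply contDiffAt_const
        exact this.contMDiffAt.comp r (contMDiffAt_extChartAt' (by simpa using hr)))
  refine ⟨h, ?_, ?_⟩
  · have hcont : Filter.Tendsto φ (𝓝 q) (𝓝 a) := continuousAt_extChartAt' hq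
    filter_upwards [hcont.eventually hη1, Filter.eventually_all.2 hh,
      (isOpen_extChartAt_source c).mem_nhds hq] with r h1 h2 h3
    ext k
    have key := hG1 k (φ r)
    rw [h1, hη1.self_of_nhds, one_smul, one_smul, chartCoeff, chartCoeff, ← hφ, φ.left_inv h3, ha,
      φ.left_inv hq] at key
    have hsum : φ r - φ q = ∑ b, (φ r b - φ q b) • EuclideanSpace.single b (1 : ℝ) := by
      ext b
      simp [Finset.sum_apply, Pi.single_apply]
    rw [map_add, map_sum, ← sub_eq_iff_eq_add', key, hsum, map_sum]
    refine Finset.sum_congr rfl fun b _ => ?_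
    rw [MvPowerSeries.coeff_C_mul, h2, map_smul]
    simp [ha]
  · intro b
    rw [(hh b).self_of_nhds]
    ext k
    rw [coeff_chartDeriv, coeff_ofCoeff, hG2]
    congr 1
    refine Filter.EventuallyEq.fderiv_eq ?_
    filter_upwards [hη1] with w hw
    rw [hw, one_smul]

/-- The functions `u b` extend the chart coordinates and the `δ b` extend the coordinate fields. The
expansion says that a derivation is determined near `c` by its values on the coordinates. -/
theorem exists_chart_frame (c : M) :
    ∃ (u : Fin (2 * n) → Fn n M σ) (δ : Fin (2 * n) → VF n M σ),
      (∀ᶠ q in 𝓝 c, ∀ (X : VF n M σ) (f : Fn n M σ),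
        ev q (X f) = ∑ b, ev q (X (u b)) * ev q (δ b f)) ∧
      ∀ b f, MvPowerSeries.constantCoeff (ev c (δ b f)) =
        leadingDifferential f c (EuclideanSpace.single b 1) := by
  have hc : c ∈ (extChartAt (𝓡 (2 * n)) c).source := mem_extChartAt_source c
  obtain ⟨χ, hχ1, hχ0⟩ := exists_cutoff (σ := σ) (n := n) (isOpen_extChartAt_source c) hc
  choose δ hδ using fun b : Fin (2 * n) =>
    exists_chart_derivation c χ hχ0 (EuclideanSpace.single b 1)
  choose u hu _ using fun b : Fin (2 * n) =>
    exists_extension (n := n) (σ := σ) (isOpen_extChartAt_source c) hc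
      (fun r => MvPowerSeries.C ((extChartAt (𝓡 (2 * n)) c r b : ℝ) : ℂ)) (by
        classical
        intro k r hr
        have h1 : ContDiffAt ℝ (⊤ : ℕ∞)
            (fun w : EuclideanSpace ℝ (Fin (2 * n)) => ((w b : ℝ) : ℂ))
            (extChartAt (𝓡 (2 * n)) c r) :=
          (Complex.ofRealCLM.contDiff.comp (EuclideanSpace.proj (𝕜 := ℝ) b).contDiff).contDiffAt
        have h2 : ContMDiffAt (𝓡 (2 * n)) 𝓘(ℝ, ℂ) (⊤ : ℕ∞)
            (fun p => ((extChartAt (𝓡 (2 * n)) c p b : ℝ) : ℂ)) r :=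
          h1.contMDiffAt.comp r (contMDiffAt_extChartAt' (by simpa using hr))
        simp only [MvPowerSeries.coeff_C]
        by_cases hk : k = 0
        · simpa [hk] using h2
        · simp only [hk, if_false]
          exact contMDiffAt_const)
  refine ⟨u, δ, ?_, ?_⟩
  -- The `u b` have to agree with the coordinates on a neighbourhood of `q`, since X sees germs and
  -- not values.
  · filter_upwards [hχ1, eventually_eventually_nhds.2 (Filter.eventually_all.2 hu),
      (isOpen_extChartAt_source c).mem_nhds hc] with q h1 h2 h3 X f
    obtain ⟨h, hh, hh'⟩ := exists_local_hadamard h3 f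
    -- X kills the constants, and the factors u_b - u_b(q) vanish at `q`, so by Leibniz only X(u_b)
    -- h_b(q) survives.
    have : ev q (X f) = ev q (X (algebraMap _ _ (ev q f) +
        ∑ b, (u b - algebraMap _ _ (ev q (u b))) * h b)) := by
      refine ev_derivation_congr X ?_
      filter_upwards [hh, h2] with r hr hr'
      rw [hr]
      simp [hr', h2.self_of_nhds]
    rw [this]
    simp [Derivation.leibniz, hδ, h1, hh', mul_comm]
  · intro b f
    rw [hδ, hχ1.self_of_nhds, one_mul, leadingDifferential_eq]

end

/-! ### Frames dual to given coordinates; Darboux frames. -/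

section
variable {n : ℕ} {M σ : Type*} [TopologicalSpace M]
  [ChartedSpace (EuclideanSpace ℝ (Fin (2 * n))) M] [IsManifold (𝓡 (2 * n)) (⊤ : ℕ∞) M]
  [T2Space M]

omit [IsManifold (𝓡 (2 * n)) (⊤ : ℕ∞) M] [T2Space M] in
theorem ev_sum_smul_apply {ι : Type*} (s : Finset ι) (q : M) (g : ι → Fn n M σ)
    (X : ι → VF n M σ) (f : Fn n M σ) :
    ev q ((∑ i ∈ s, g i • X i) f) = ∑ i ∈ s, ev q (g i) * ev q (X i f) := by
  have h : (∑ i ∈ s, g i • X i) f = ∑ i ∈ s, g i * X i f := by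
    rw [← Derivation.coeFnAddMonoidHom_apply, map_sum, Finset.sum_apply]
    rfl
  rw [h, map_sum]
  simp

/-- Evaluation on the standard real basis is an injective ℂ-linear map on complex covectors, so
independent covectors give independent rows. -/
theorem det_apply_single_ne_zero {ι : Type*} [Fintype ι] [DecidableEq ι] {m : ℕ}
    (κ : ι ≃ Fin m) {w : ι → EuclideanSpace ℝ (Fin m) →L[ℝ] ℂ} (hw : LinearIndependent ℂ w) :
    (Matrix.of fun a b => w a (EuclideanSpace.single (κ b) 1)).det ≠ 0 := by
  let L : (EuclideanSpace ℝ (Fin m) →L[ℝ] ℂ) →ₗ[ℂ] (ι → ℂ) :=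
    { toFun := fun w b => w (EuclideanSpace.single (κ b) 1)
      map_add' := fun _ _ => rfl
      map_smul' := fun _ _ => rfl }
  have hL : LinearMap.ker L = ⊥ := by
    refine LinearMap.ker_eq_bot'.2 fun v hv => ?_
    have h : (v : EuclideanSpace ℝ (Fin m) →ₗ[ℝ] ℂ) = 0 := by
      refine (EuclideanSpace.basisFun (Fin m) ℝ).toBasis.ext fun b => ?_
      have := congrFun hv (κ.symm b)
      simpa [L] using this
    ext x
    exact LinearMap.congr_fun h x
  have h := hw.map' L hL
  have h2 := (Matrix.linearIndependent_rows_iff_isUnit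
    (A := Matrix.of fun a b => w a (EuclideanSpace.single (κ b) 1))).1 h
  exact ((Matrix.isUnit_iff_isUnit_det _).1 h2).ne_zero

/-- The leading term of the Jacobian determinant of `z` against the chart fields is nonzero at `p`,
so the determinant is invertible nearby and the inverse Jacobian turns the chart frame into the
frame dual to `z`. -/
theorem exists_dual_frame {ι : Type*} [Fintype ι] [DecidableEq ι] (κ : ι ≃ Fin (2 * n))
    (z : ι → Fn n M σ) (p : M)
    (hz : LinearIndependent ℂ fun a => leadingDifferential (z a) p) :
    ∃ e : ι → VF n M σ, ∀ᶠ q in 𝓝 p,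
      (∀ a b, ev q (e a (z b)) = if a = b then 1 else 0) ∧
      ∀ (X : VF n M σ) (f : Fn n M σ), ev q (X f) = ∑ a, ev q (X (z a)) * ev q (e a f) := by
  obtain ⟨u, δ, hu, hδ⟩ := exists_chart_frame (σ := σ) (n := n) p
  let J : Matrix ι ι (Fn n M σ) := Matrix.of fun a b => δ (κ b) (z a)
  have hJ : MvPowerSeries.constantCoeff (ev p J.det) ≠ 0 := by
    have h := det_apply_single_ne_zero κ hz
    have h2 : MvPowerSeries.constantCoeff (ev p J.det) =
      ((MvPowerSeries.constantCoeff (σ := σ) (R := ℂ)).comp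
        (ev p : Fn n M σ →ₐ[Scalars σ] Scalars σ).toRingHom) J.det := rfl
    rw [h2, RingHom.map_det]
    convert h using 2
    ext a b
    exact hδ (κ b) (z a)
  obtain ⟨g, hg⟩ := exists_local_inverse J.det hJ
  -- Near `p` the matrix `g` times the adjugate is the inverse Jacobian. Duality uses that it is a
  -- right inverse, the expansion of X that it is a left inverse.
  refine ⟨fun a => ∑ b, (g * J.adjugate b a) • δ (κ b), ?_⟩
  filter_upwards [hu, hg] with q hq hgq
  constructor
  · intro a c
    have h : ∑ b, g * J.adjugate b a * J c b = g * (J.det * (1 : Matrix ι ι (Fn n M σ)) c a) := by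
      have := congrFun (congrFun (Matrix.mul_adjugate J) c) a
      rw [Matrix.mul_apply, Matrix.smul_apply, smul_eq_mul] at this
      rw [← this, Finset.mul_sum]
      exact Finset.sum_congr rfl fun b _ => by ring
    have h2 := congrArg (ev q) h
    rw [map_sum] at h2
    simp only [map_mul] at h2
    rw [ev_sum_smul_apply]
    simp only [map_mul]
    refine h2.trans ?_
    rw [← mul_assoc, mul_comm (ev q g), hgq, one_mul, Matrix.one_apply]
    by_cases hac : a = c
    · simp [hac]
    · simp [hac, Ne.symm hac]
  · intro X f
    have hB : ∀ b b', ∑ a, ev q (g * J.adjugate b' a) * ev q (J a b) = if b' = b then 1 else 0 := by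
      intro b b'
      have := congrFun (congrFun (Matrix.adjugate_mul J) b') b
      rw [Matrix.mul_apply, Matrix.smul_apply, smul_eq_mul] at this
      have h2 := congrArg (ev q) (congrArg (g * ·) this)
      simp only [Finset.mul_sum, map_sum, map_mul] at h2
      simp only [map_mul, mul_assoc]
      rw [h2, ← mul_assoc, mul_comm (ev q g), hgq, one_mul, Matrix.one_apply]
      split_ifs <;> simp
    have hX : ∀ a, ev q (X (z a)) = ∑ b, ev q (X (u (κ b))) * ev q (J a b) := by
      intro a
      rw [hq X (z a)]
      exact (Equiv.sum_comp κ fun b => ev q (X (u b)) * ev q (δ b (z a))).symm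
    simp only [ev_sum_smul_apply, hX, Finset.sum_mul, Finset.mul_sum]
    rw [hq X f, ← Equiv.sum_comp κ, Finset.sum_comm]
    refine Finset.sum_congr rfl fun b _ => ?_
    rw [Finset.sum_comm]
    have : ∀ b', ∑ a, ev q (X (u (κ b'))) * ev q (J a b') *
        (ev q (g * J.adjugate b a) * ev q (δ (κ b) f)) =
        ev q (X (u (κ b'))) * ev q (δ (κ b) f) * if b = b' then 1 else 0 := by
      intro b'
      rw [← hB b' b, Finset.mul_sum]
      exact Finset.sum_congr rfl fun a _ => by ring
    exact (Eq.trans (Finset.sum_congr rfl fun b' _ => this b') (by simp)).symm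

/-- A frame of vector fields on `V` dual to Darboux coordinates adapted to the polarization. -/
structure DarbouxFrame (ω : TwoTensor (Scalars σ) (Fn n M σ))
    (P : Submodule (Fn n M σ) (VF n M σ)) (V : Set M) where
  x : Fin n → Fn n M σ
  y : Fin n → Fn n M σ
  ex : Fin n → VF n M σ
  ey : Fin n → VF n M σ
  isOpen : IsOpen V
  ey_mem : ∀ i, ey i ∈ P
  ex_x : ∀ q ∈ V, ∀ i j, ev q (ex i (x j)) = if i = j then 1 else 0
  ex_y : ∀ q ∈ V, ∀ i j, ev q (ex i (y j)) = 0
  ey_x : ∀ q ∈ V, ∀ i j, ev q (ey i (x j)) = 0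
  ey_y : ∀ q ∈ V, ∀ i j, ev q (ey i (y j)) = if i = j then 1 else 0
  expand : ∀ q ∈ V, ∀ (X : VF n M σ) (f : Fn n M σ), ev q (X f) =
    ∑ i, ev q (X (x i)) * ev q (ex i f) + ∑ i, ev q (X (y i)) * ev q (ey i f)
  omega : ∀ q ∈ V, ∀ X Y : VF n M σ, ev q (ω X Y) =
    ∑ i, (ev q (X (y i)) * ev q (Y (x i)) - ev q (X (x i)) * ev q (Y (y i)))
  mem_iff : ∀ q ∈ V, ∀ X : VF n M σ, GermMem P q X ↔ ∀ᶠ r in 𝓝 q, ∀ i, ev r (X (x i)) = 0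

omit [IsManifold (𝓡 (2 * n)) (⊤ : ℕ∞) M] [T2Space M] in
theorem DarbouxFrame.apply_x {ω : TwoTensor (Scalars σ) (Fn n M σ)}
    {P : Submodule (Fn n M σ) (VF n M σ)} {V : Set M} (B : DarbouxFrame ω P V) {X : VF n M σ}
    (hX : X ∈ P) {q : M} (hq : q ∈ V) (i : Fin n) : ev q (X (B.x i)) = 0 :=
  ((B.mem_iff q hq X).1 ⟨X, hX, Filter.Eventually.of_forall fun _ _ => rfl⟩).self_of_nhds i

omit [IsManifold (𝓡 (2 * n)) (⊤ : ℕ∞) M] [T2Space M] in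
theorem germMem_zero (P : Submodule (Fn n M σ) (VF n M σ)) {q : M} {X : VF n M σ}
    (h : ∀ᶠ r in 𝓝 q, ∀ f : Fn n M σ, ev r (X f) = 0) : GermMem P q X := by
  refine ⟨0, P.zero_mem, ?_⟩
  filter_upwards [h] with r hr f
  rw [valueAt_eq_ev, hr f]
  exact (map_zero (ev (n := n) (σ := σ) r)).symm

theorem IsPolarizedSymplectic.exists_darbouxFrame {ω : TwoTensor (Scalars σ) (Fn n M σ)}
    {P : Submodule (Fn n M σ) (VF n M σ)} (hP : IsPolarizedSymplectic ω P) (p : M) :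
    ∃ V : Set M, p ∈ V ∧ Nonempty (DarbouxFrame ω P V) := by
  obtain ⟨U, hU, hpU, x, y, ⟨hlin, hω⟩, hmem⟩ := hP.polarization p
  obtain ⟨e, he⟩ := exists_dual_frame
    (finSumFinEquiv.trans (finCongr (two_mul n).symm)) (Sum.elim x y) p (hlin p hpU)
  obtain ⟨W, hW, hWo, hpW⟩ := eventually_nhds_iff.1 he
  -- The cut-off makes each y-direction field a global section of P: on U ∩ W it kills the `x j`,
  -- and elsewhere its germ is zero. On V, where χ = 1, the dual frame is unchanged.
  obtain ⟨χ, hχ1, hχ0⟩ := exists_cutoff (σ := σ) (n := n) (hU.inter hWo) ⟨hpU, hpW⟩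
  obtain ⟨V, hV, hVo, hpV⟩ := eventually_nhds_iff.1 (hχ1.and ((hU.inter hWo).mem_nhds ⟨hpU, hpW⟩))
  have hes : ∀ q ∈ V, ∀ a f, ev q ((χ • e a) f) = ev q (e a f) := by
    intro q hq a f
    simp [(hV q hq).1]
  refine ⟨V, hpV, ⟨⟨x, y, fun i => χ • e (Sum.inl i), fun i => χ • e (Sum.inr i), hVo,
    ?_, ?_, ?_, ?_, ?_, ?_, ?_, ?_⟩⟩⟩
  · intro i
    refine hP.sheaf _ fun q => ?_
    by_cases hq : q ∈ U ∩ W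
    · refine (hmem q hq.1 _).2 ?_
      filter_upwards [hWo.mem_nhds hq.2] with r hr j
      have := (hW r hr).1 (Sum.inr i) (Sum.inl j)
      simp only [Sum.elim_inl] at this
      simp [valueAt_eq_ev, this]
    · refine germMem_zero P ?_
      filter_upwards [hχ0 q hq] with r hr f
      simp [hr]
  · intro q hq i j
    simpa using (show _ = _ from hes q hq _ _).trans ((hW q (hV q hq).2.2).1 (Sum.inl i) (Sum.inl j))
  · intro q hq i j
    simpa using (show _ = _ from hes q hq _ _).trans ((hW q (hV q hq).2.2).1 (Sum.inl i) (Sum.inr j))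
  · intro q hq i j
    simpa using (show _ = _ from hes q hq _ _).trans ((hW q (hV q hq).2.2).1 (Sum.inr i) (Sum.inl j))
  · intro q hq i j
    simpa using (show _ = _ from hes q hq _ _).trans ((hW q (hV q hq).2.2).1 (Sum.inr i) (Sum.inr j))
  · intro q hq X f
    simp only [hes q hq]
    simpa using (hW q (hV q hq).2.2).2 X f
  · intro q hq X Y
    simpa [valueAt_eq_ev] using hω X Y q (hV q hq).2.1
  · exact fun q hq X => hmem q (hV q hq).2.1 X

end

/-! ### Gluing by a partition of unity. -/

section
variable {n : ℕ} {M σ : Type*} [TopologicalSpace M]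
  [ChartedSpace (EuclideanSpace ℝ (Fin (2 * n))) M] {ι : Type*}

theorem ev_glue_aux (ρ : SmoothPartitionOfUnity ι (𝓡 (2 * n)) M Set.univ) (g : ι → Fn n M σ) :
    ∃ f : Fn n M σ, ∀ q, ev q f =
      ∑ i ∈ ρ.finsupport q, MvPowerSeries.C ((ρ i q : ℝ) : ℂ) * ev q (g i) := by
  refine exists_ev_eq _ fun k => ?_
  have h := ρ.contMDiff_finsum_smul (n := (⊤ : ℕ∞)) (F := ℂ)
    (g := fun i q => MvPowerSeries.coeff k (ev q (g i)))
    fun i q _ => (contMDiff_coeff_ev (g i) k).contMDiffAt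
  convert h using 2 with q
  rw [← ρ.sum_finsupport_smul_eq_finsum q (fun i q => MvPowerSeries.coeff k (ev q (g i))), map_sum]
  simp [MvPowerSeries.coeff_C_mul]

/-- Formal functions glued by means of a partition of unity. -/
def glue (ρ : SmoothPartitionOfUnity ι (𝓡 (2 * n)) M Set.univ) :
    (ι → Fn n M σ) →ₗ[Fn n M σ] Fn n M σ where
  toFun g := (ev_glue_aux ρ g).choose
  map_add' g g' := Fn.ext_ev fun q => by
    rw [map_add, (ev_glue_aux ρ _).choose_spec, (ev_glue_aux ρ _).choose_spec,
      (ev_glue_aux ρ _).choose_spec, ← Finset.sum_add_distrib]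
    exact Finset.sum_congr rfl fun i _ => by rw [Pi.add_apply, map_add, mul_add]
  map_smul' f g := Fn.ext_ev fun q => by
    rw [RingHom.id_apply, smul_eq_mul, map_mul, (ev_glue_aux ρ _).choose_spec,
      (ev_glue_aux ρ _).choose_spec, Finset.mul_sum]
    exact Finset.sum_congr rfl fun i _ => by
      rw [Pi.smul_apply, smul_eq_mul, map_mul, mul_left_comm]

theorem ev_glue (ρ : SmoothPartitionOfUnity ι (𝓡 (2 * n)) M Set.univ) (g : ι → Fn n M σ) (q : M) :
    ev q (glue ρ g) = ∑ i ∈ ρ.finsupport q, MvPowerSeries.C ((ρ i q : ℝ) : ℂ) * ev q (g i) :=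
  (ev_glue_aux ρ g).choose_spec q

theorem ev_glue_congr (ρ : SmoothPartitionOfUnity ι (𝓡 (2 * n)) M Set.univ) {g g' : ι → Fn n M σ}
    {q : M} (h : ∀ i, ρ i q ≠ 0 → ev q (g i) = ev q (g' i)) :
    ev q (glue ρ g) = ev q (glue ρ g') := by
  rw [ev_glue, ev_glue]
  exact Finset.sum_congr rfl fun i hi => by rw [h i (by simpa using hi)]

theorem ev_glue_eq (ρ : SmoothPartitionOfUnity ι (𝓡 (2 * n)) M Set.univ) {g : ι → Fn n M σ}
    {q : M} {c : Scalars σ} (h : ∀ i, ρ i q ≠ 0 → ev q (g i) = c) : ev q (glue ρ g) = c := by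
  rw [ev_glue, Finset.sum_congr rfl fun i hi => by rw [h i (by simpa using hi)],
    ← Finset.sum_mul, ← map_sum, ← Complex.ofReal_sum, ρ.sum_finsupport q (Set.mem_univ q)]
  simp

theorem glue_const (ρ : SmoothPartitionOfUnity ι (𝓡 (2 * n)) M Set.univ) (f : Fn n M σ) :
    glue ρ (fun _ => f) = f :=
  Fn.ext_ev fun _ => ev_glue_eq ρ fun _ _ => rfl

/-- Vector fields glued by means of a partition of unity. -/
def glueField (ρ : SmoothPartitionOfUnity ι (𝓡 (2 * n)) M Set.univ) :
    (ι → VF n M σ) →ₗ[Fn n M σ] VF n M σ where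
  toFun X := Derivation.mk'
    { toFun := fun f => glue ρ fun i => X i f
      map_add' := fun f g => by
        rw [← map_add]
        congr 1
        funext i
        exact (X i).map_add f g
      map_smul' := fun c f => by
        rw [RingHom.id_apply, ← algebraMap_smul (Fn n M σ) c (glue ρ fun i => X i f), ← map_smul]
        congr 1
        funext i
        rw [Pi.smul_apply, algebraMap_smul, Derivation.map_smul] }
    (fun f g => by
      simp only [LinearMap.coe_mk, AddHom.coe_mk]
      rw [← map_smul, ← map_smul, ← map_add]
      congr 1
      funext i
      exact (X i).leibniz f g)
  map_add' X Y := Derivation.ext fun f => (glue ρ).map_add (fun i => X i f) fun i => Y i f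
  map_smul' g X := Derivation.ext fun f => (glue ρ).map_smul g fun i => X i f

theorem glueField_apply (ρ : SmoothPartitionOfUnity ι (𝓡 (2 * n)) M Set.univ) (X : ι → VF n M σ)
    (f : Fn n M σ) : glueField ρ X f = glue ρ fun i => X i f := rfl

theorem glueField_const (ρ : SmoothPartitionOfUnity ι (𝓡 (2 * n)) M Set.univ) (X : VF n M σ) :
    glueField ρ (fun _ => X) = X :=
  Derivation.ext fun f => glue_const ρ (X f)

theorem glueField_congr (ρ : SmoothPartitionOfUnity ι (𝓡 (2 * n)) M Set.univ)
    {X Y : ι → VF n M σ} (h : ∀ i q, ρ i q ≠ 0 → VEq q (X i) (Y i)) :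
    glueField ρ X = glueField ρ Y :=
  Derivation.ext fun f => Fn.ext_ev fun q => ev_glue_congr ρ fun i hi => h i q hi f

variable [IsManifold (𝓡 (2 * n)) (⊤ : ℕ∞) M] [T2Space M] [SigmaCompactSpace M]
  {ω : TwoTensor (Scalars σ) (Fn n M σ)} {P : Submodule (Fn n M σ) (VF n M σ)}

theorem IsPolarizedSymplectic.exists_atlas (hP : IsPolarizedSymplectic ω P) :
    ∃ (V : M → Set M) (_ : ∀ p, DarbouxFrame ω P (V p))
      (ρ : SmoothPartitionOfUnity M (𝓡 (2 * n)) M Set.univ),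
      (∀ p, p ∈ V p) ∧ ∀ p q, ρ p q ≠ 0 → q ∈ V p := by
  choose V hV B using hP.exists_darbouxFrame
  obtain ⟨ρ, hρ⟩ := SmoothPartitionOfUnity.exists_isSubordinate (𝓡 (2 * n)) isClosed_univ V
    (fun p => (B p).some.isOpen) (fun p _ => Set.mem_iUnion.2 ⟨p, hV p⟩)
  exact ⟨V, fun p => (B p).some, ρ, hV, fun p q h => hρ p (subset_tsupport _ h)⟩

end

/-! ### The trace on a fibre of a module with a local frame. -/

section
variable {K F : Type*} [CommRing K] [CommRing F] [Algebra K F]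

theorem Connection.toFun_zero (D : Connection K F) (X : Derivation K F F) : D.toFun X 0 = 0 := by
  simpa using D.add_right X 0 0

theorem Connection.toFun_sum (D : Connection K F) (X : Derivation K F F) {ι : Type*}
    (s : Finset ι) (Y : ι → Derivation K F F) :
    D.toFun X (∑ i ∈ s, Y i) = ∑ i ∈ s, D.toFun X (Y i) :=
  map_sum (AddMonoidHom.mk' (D.toFun X) (D.add_right X)) Y s

/-- The trace of an endomorphism on a fibre, computed in a local frame. -/
theorem trace_fibre_eq_sum {P : Submodule F (Derivation K F F)} {I : Ideal F} {ι : Type*}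
    [Fintype ι] [DecidableEq ι] (φ : F →ₐ[K] K) (hI : ∀ f, f ∈ I ↔ φ f = 0) (e : ι → P) (y : ι → F)
    (hy : ∀ i j, φ ((e i : Derivation K F F) (y j)) = if i = j then 1 else 0) (χ : F)
    (hχ : φ χ = 1)
    (he : ∀ Z : P, χ • Z = ∑ i, (χ * (Z : Derivation K F F) (y i)) • e i) (T : P →ₗ[F] P) :
    LinearMap.trace K (Fibre P I) (LinearMap.restrictScalars K (Submodule.mapQ _ _ T
      (Submodule.smul_top_le_comap_smul_top I T))) =
      ∑ i, φ ((T (e i) : Derivation K F F) (y i)) := by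
  -- On the fibre, f acts as the constant φ(f), because f - φ(f) lies in `I`.
  have hmk : ∀ (f : F) (Z : P), (Submodule.Quotient.mk (f • Z) : Fibre P I) =
      φ f • Submodule.Quotient.mk Z := by
    intro f Z
    rw [← Submodule.Quotient.mk_smul, Submodule.Quotient.eq, ← algebraMap_smul F (φ f) Z,
      show f • Z - algebraMap K F (φ f) • Z = (f - algebraMap K F (φ f)) • Z from
        Subtype.ext (sub_smul _ _ (Z : Derivation K F F)).symm]
    refine Submodule.smul_mem_smul ((hI _).2 ?_) trivial
    simp
  have hev : ∀ (i : ι) (Z : P), Z ∈ I • (⊤ : Submodule F P) →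
      φ ((Z : Derivation K F F) (y i)) = 0 := by
    intro i Z hZ
    refine Submodule.smul_induction_on hZ ?_ ?_
    · intro f hf W _
      simp [(hI f).1 hf]
    · intro W W' h h'
      simp [h, h']
  -- Multiplication by χ is the identity on the fibre, so the cut-off expansion `he` becomes a
  -- genuine one; the functionals Z ↦ φ(Z y_j) are then the dual basis.
  have hspan : ∀ Z : P, (Submodule.Quotient.mk Z : Fibre P I) =
      ∑ i, φ ((Z : Derivation K F F) (y i)) • Submodule.Quotient.mk (e i) := by
    intro Z
    have h2 := congrArg (Submodule.Quotient.mk (p := I • (⊤ : Submodule F P))) (he Z)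
    rw [hmk, hχ, one_smul] at h2
    rw [h2, ← Submodule.mkQ_apply, map_sum]
    refine Finset.sum_congr rfl fun i _ => ?_
    rw [Submodule.mkQ_apply, hmk, map_mul, hχ, one_mul]
  have hfun : ∀ (j : ι) (c : ι → F), φ (((∑ i, c i • e i : P) : Derivation K F F) (y j)) =
      φ (c j) := by
    intro j c
    let L : P →ₗ[F] F :=
      { toFun := fun Z => (Z : Derivation K F F) (y j)
        map_add' := fun _ _ => rfl
        map_smul' := fun _ _ => rfl }
    have h : ((∑ i, c i • e i : P) : Derivation K F F) (y j) =
        ∑ i, c i * (e i : Derivation K F F) (y j) := map_sum L (fun i => c i • e i) _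
    rw [h, map_sum]
    simp [hy]
  have hcomb : ∀ c : ι → K, ∑ i, c i • (Submodule.Quotient.mk (e i) : Fibre P I) =
      Submodule.Quotient.mk (∑ i, algebraMap K F (c i) • e i) := by
    intro c
    rw [← Submodule.mkQ_apply _ (∑ i, _), map_sum]
    refine Finset.sum_congr rfl fun i _ => ?_
    rw [Submodule.mkQ_apply, hmk]
    simp
  have hli : LinearIndependent K fun i : ι => (Submodule.Quotient.mk (e i) : Fibre P I) := by
    rw [Fintype.linearIndependent_iff]
    intro c hc j
    rw [hcomb, Submodule.Quotient.mk_eq_zero] at hc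
    have := hev j _ hc
    rw [hfun] at this
    simpa using this
  let b : Module.Basis ι K (Fibre P I) := Module.Basis.mk hli (by
    rintro x -
    obtain ⟨Z, rfl⟩ := Submodule.Quotient.mk_surjective _ x
    rw [hspan Z]
    exact Submodule.sum_mem _ fun i _ =>
      Submodule.smul_mem _ _ (Submodule.subset_span ⟨i, rfl⟩))
  have hb : ∀ i, b i = Submodule.Quotient.mk (e i) := fun i => by
    simp [b]
  have hrepr : ∀ (Z : P) (j : ι), b.repr (Submodule.Quotient.mk Z) j =
      φ ((Z : Derivation K F F) (y j)) := by
    intro Z j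
    rw [hspan Z]
    simp only [← hb]
    rw [map_sum, Finsupp.finsetSum_apply]
    simp [Finsupp.single_apply]
  refine (LinearMap.trace_eq_matrix_trace K b _).trans ?_
  refine Finset.sum_congr rfl fun i _ => ?_
  rw [Matrix.diag_apply, LinearMap.toMatrix_apply, hb, LinearMap.restrictScalars_apply,
    Submodule.mapQ_apply, hrepr]

end

/-! ### Connections and curvature in a Darboux frame. -/

section
variable {n : ℕ} {M σ : Type*} [TopologicalSpace M]
  [ChartedSpace (EuclideanSpace ℝ (Fin (2 * n))) M] [IsManifold (𝓡 (2 * n)) (⊤ : ℕ∞) M]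
  [T2Space M] {ω : TwoTensor (Scalars σ) (Fn n M σ)} {P : Submodule (Fn n M σ) (VF n M σ)}
  {V : Set M}

theorem ev_derivation_of_eventually_eq_const (X : VF n M σ) {f : Fn n M σ} {q : M} {c : Scalars σ}
    (h : ∀ᶠ r in 𝓝 q, ev r f = c) : ev q (X f) = 0 := by
  rw [ev_derivation_congr X (g := algebraMap _ _ c) (by simpa using h)]
  simp

namespace DarbouxFrame

omit [IsManifold (𝓡 (2 * n)) (⊤ : ℕ∞) M] [T2Space M] in
/-- A section of the polarization is a combination of the vector fields `ey i`. -/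
theorem veq_of_mem (B : DarbouxFrame ω P V) {Z : VF n M σ} (hZ : Z ∈ P) {q : M} (hq : q ∈ V) :
    VEq q Z (∑ i, Z (B.y i) • B.ey i) := by
  intro f
  rw [B.expand q hq Z f, ev_sum_smul_apply]
  simp [B.apply_x hZ hq]

/-- Along the polarization, a torsion-free symplectic connection that preserves the polarization
is the flat connection of Darboux coordinates. -/
theorem connection_ey_veq_zero (B : DarbouxFrame ω P V)
    {D : Connection (Scalars σ) (Fn n M σ)}
    (ht : ∀ X Y : VF n M σ, D.toFun X Y - D.toFun Y X = ⁅X, Y⁆)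
    (hs : ∀ X Y Z : VF n M σ, X (ω Y Z) = ω (D.toFun X Y) Z + ω Y (D.toFun X Z))
    (hp : D.Preserves P) {X : VF n M σ} (hX : X ∈ P) (i : Fin n) {q : M} (hq : q ∈ V) :
    VEq q (D.toFun X (B.ey i)) 0 := by
  have hV : ∀ᶠ r in 𝓝 q, r ∈ V := B.isOpen.mem_nhds hq
  have hm := hp X _ (B.ey_mem i)
  have hy : ∀ j, ev q (D.toFun X (B.ey i) (B.y j)) = 0 := by
    intro j
    have h1 : ev q (X (ω (B.ey i) (B.ex j))) = 0 := by
      refine ev_derivation_of_eventually_eq_const X (c := if i = j then 1 else 0) ?_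
      filter_upwards [hV] with r hr
      rw [B.omega r hr]
      simp [B.ey_x r hr, B.ey_y r hr, B.ex_x r hr, B.ex_y r hr]
    -- Pairing with `ex j` reads off the j-th y-component, and pairing with `ey i` reads off the
    -- i-th x-component.
    have h2 : ev q (ω (D.toFun X (B.ey i)) (B.ex j)) = ev q (D.toFun X (B.ey i) (B.y j)) := by
      rw [B.omega q hq]
      simp [B.ex_x q hq, B.ex_y q hq]
    have h3 : ev q (ω (B.ey i) (D.toFun X (B.ex j))) = ev q (D.toFun X (B.ex j) (B.x i)) := by
      rw [B.omega q hq]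
      simp [B.ey_x q hq, B.ey_y q hq]
    -- Torsion-freeness trades ∇_X ex_j for ∇_{ex_j} X, which lies in P, plus a bracket. The bracket
    -- kills x_i because ex_j(x_i) and X(x_i) are both locally constant.
    have h4 : ev q (D.toFun X (B.ex j) (B.x i)) = 0 := by
      rw [sub_eq_iff_eq_add'.1 (ht X (B.ex j)), Derivation.add_apply, map_add,
        B.apply_x (hp _ _ hX) hq, Derivation.commutator_apply, map_sub,
        ev_derivation_of_eventually_eq_const X (f := B.ex j (B.x i))
          (by filter_upwards [hV] with r hr using B.ex_x r hr j i),
        ev_derivation_of_eventually_eq_const (B.ex j) (f := X (B.x i))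
          (by filter_upwards [hV] with r hr using B.apply_x hX hr i)]
      simp
    have h5 := congrArg (ev q) (hs X (B.ey i) (B.ex j))
    rw [h1, map_add, h2, h3, h4, add_zero] at h5
    exact h5.symm
  intro f
  rw [B.expand q hq]
  simp [hy, B.apply_x hm hq]

/-- Flatness along the polarization is automatic. -/
theorem curvature_veq_zero (B : DarbouxFrame ω P V)
    {D : Connection (Scalars σ) (Fn n M σ)}
    (ht : ∀ X Y : VF n M σ, D.toFun X Y - D.toFun Y X = ⁅X, Y⁆)
    (hs : ∀ X Y Z : VF n M σ, X (ω Y Z) = ω (D.toFun X Y) Z + ω Y (D.toFun X Z))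
    (hp : D.Preserves P) {X Y Z : VF n M σ} (hX : X ∈ P) (hY : Y ∈ P) (hZ : Z ∈ P) {q : M}
    (hq : q ∈ V) : VEq q (D.curvature X Y Z) 0 := by
  have hV := B.isOpen.eventually_mem hq
  -- Involutivity of P comes from the connection itself, being torsion-free and preserving P.
  have hXY : ⁅X, Y⁆ ∈ P := by
    rw [← ht]
    exact P.sub_mem (hp _ _ hY) (hp _ _ hX)
  have hcurv : ∀ W W' : VF n M σ, (∀ r ∈ V, VEq r W W') →
      VEq q (D.curvature X Y W) (D.curvature X Y W') := by
    intro W W' h f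
    have hl : ∀ (A : VF n M σ), ∀ r ∈ V, VEq r (D.toFun A W) (D.toFun A W') := fun A r hr =>
      D.veq_right A (by filter_upwards [B.isOpen.mem_nhds hr] with s hs using h s hs)
    have h1 := D.veq_right X (hV.mono fun r hr => hl Y r hr) f
    have h2 := D.veq_right Y (hV.mono fun r hr => hl X r hr) f
    have h3 := hl ⁅X, Y⁆ q hq f
    change ev q ((_ - _ - _ : VF n M σ) f) = ev q ((_ - _ - _ : VF n M σ) f)
    simp only [Derivation.sub_apply, map_sub, h1, h2, h3]
  have hey : ∀ i f, ev q (D.curvature X Y (B.ey i) f) = 0 := by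
    intro i f
    have h0 : ∀ A : VF n M σ, A ∈ P → ∀ r ∈ V, VEq r (D.toFun A (B.ey i)) 0 :=
      fun A hA r hr => B.connection_ey_veq_zero ht hs hp hA i hr
    have h1 := D.veq_right X (hV.mono fun r hr => h0 Y hY r hr) f
    have h2 := D.veq_right Y (hV.mono fun r hr => h0 X hX r hr) f
    have h3 := h0 _ hXY q hq f
    change ev q ((_ - _ - _ : VF n M σ) f) = 0
    simp only [Derivation.sub_apply, map_sub, h1, h2, h3, D.toFun_zero]
    simp
  intro f
  rw [hcurv Z _ (fun r hr => B.veq_of_mem hZ hr) f, map_sum]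
  simp only [map_smul]
  rw [ev_sum_smul_apply]
  simp [hey]

/-- The trace of the connection form on the polarization in the frame `ey`. -/
def connectionTrace (B : DarbouxFrame ω P V) (D : Connection (Scalars σ) (Fn n M σ)) :
    OneForm (Scalars σ) (Fn n M σ) where
  toFun X := ∑ i, D.toFun X (B.ey i) (B.y i)
  map_add' X Y := by
    simp only [D.add_left, Derivation.add_apply, Finset.sum_add_distrib]
  map_smul' f X := by
    simp only [D.smul_left, Derivation.smul_apply, ← Finset.smul_sum, RingHom.id_apply]

omit [IsManifold (𝓡 (2 * n)) (⊤ : ℕ∞) M] [T2Space M] in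
theorem connectionTrace_apply (B : DarbouxFrame ω P V) (D : Connection (Scalars σ) (Fn n M σ))
    (X : VF n M σ) : B.connectionTrace D X = ∑ i, D.toFun X (B.ey i) (B.y i) := rfl

theorem ev_connectionTrace_of_mem (B : DarbouxFrame ω P V)
    {D : Connection (Scalars σ) (Fn n M σ)} (h : IsPSymplectic ω P D) {X : VF n M σ} (hX : X ∈ P)
    {q : M} (hq : q ∈ V) : ev q (B.connectionTrace D X) = 0 := by
  rw [connectionTrace_apply, map_sum]
  refine Finset.sum_eq_zero fun i _ => ?_
  simpa using B.connection_ey_veq_zero h.torsionFree h.symplectic h.preserves hX i hq (B.y i)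

/-- This is the structure equation R = dA + A ∧ A after taking traces, where A is the connection
matrix on P in the frame `ey`. -/
theorem ev_extDerivOne_connectionTrace (B : DarbouxFrame ω P V)
    {D : Connection (Scalars σ) (Fn n M σ)} (hp : D.Preserves P) (X Y : VF n M σ) {q : M}
    (hq : q ∈ V) : ev q (extDerivOne (B.connectionTrace D) X Y) =
      ∑ i, ev q (D.curvature X Y (B.ey i) (B.y i)) := by
  have hV := B.isOpen.eventually_mem hq
  have key : ∀ (X Y : VF n M σ) (i : Fin n), ev q (D.toFun X (D.toFun Y (B.ey i)) (B.y i)) =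
      ev q (X (D.toFun Y (B.ey i) (B.y i))) +
      ∑ j, ev q (D.toFun Y (B.ey i) (B.y j)) * ev q (D.toFun X (B.ey j) (B.y i)) := by
    intro X Y i
    rw [D.veq_right X (hV.mono fun r hr => B.veq_of_mem (hp Y _ (B.ey_mem i)) hr) (B.y i),
      D.toFun_sum]
    simp only [D.leibniz, Finset.sum_add_distrib]
    rw [Derivation.add_apply, map_add, ev_sum_smul_apply, ev_sum_smul_apply]
    simp [B.ey_y q hq]
  have hc : ∀ i, ev q (D.curvature X Y (B.ey i) (B.y i)) =
      ev q (D.toFun X (D.toFun Y (B.ey i)) (B.y i)) -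
      ev q (D.toFun Y (D.toFun X (B.ey i)) (B.y i)) - ev q (D.toFun ⁅X, Y⁆ (B.ey i) (B.y i)) := by
    intro i
    change ev q ((_ - _ - _ : VF n M σ) _) = _
    simp only [Derivation.sub_apply, map_sub]
  have hd : extDerivOne (B.connectionTrace D) X Y = X (B.connectionTrace D Y) -
    Y (B.connectionTrace D X) - B.connectionTrace D ⁅X, Y⁆ := rfl
  rw [hd]
  simp only [connectionTrace_apply, map_sub, map_sum, hc, key, Finset.sum_sub_distrib,
    Finset.sum_add_distrib]
  -- Exchanging i and j identifies the two quadratic sums, which then cancel: tr(A ∧ A) = 0.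
  rw [Finset.sum_comm (f := fun i j => ev q (D.toFun X (B.ey i) (B.y j)) *
    ev q (D.toFun Y (B.ey j) (B.y i)))]
  simp only [mul_comm]
  ring

/-- The trace of an endomorphism of the polarization on a fibre. -/
theorem trace_fibre (B : DarbouxFrame ω P V) {q : M} (hq : q ∈ V)
    (T : P →ₗ[Fn n M σ] P) :
    LinearMap.trace (Scalars σ) (Fibre P (vanishingIdeal q))
      (LinearMap.restrictScalars (Scalars σ) (Submodule.mapQ _ _ T
        (Submodule.smul_top_le_comap_smul_top (vanishingIdeal q) T))) =
      ∑ i, ev q ((T ⟨B.ey i, B.ey_mem i⟩ : VF n M σ) (B.y i)) := by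
  obtain ⟨χ, hχ1, hχ0⟩ := exists_cutoff (σ := σ) (n := n) B.isOpen hq
  refine trace_fibre_eq_sum (ev q) (fun _ => Iff.rfl) (fun i => ⟨B.ey i, B.ey_mem i⟩) B.y
    (B.ey_y q hq) χ hχ1.self_of_nhds (fun Z => ?_) T
  refine Subtype.ext (Derivation.ext fun f => Fn.ext_ev fun r => ?_)
  have h : ((∑ i, (χ * (Z : VF n M σ) (B.y i)) • (⟨B.ey i, B.ey_mem i⟩ : P) : P) : VF n M σ) =
      ∑ i, (χ * (Z : VF n M σ) (B.y i)) • B.ey i := by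
    simp
  rw [h, ev_sum_smul_apply]
  by_cases hr : r ∈ V
  · have := B.veq_of_mem Z.2 hr f
    rw [ev_sum_smul_apply] at this
    simp [this, Finset.mul_sum, mul_assoc]
  · simp [(hχ0 r hr).self_of_nhds]

end DarbouxFrame
end

/-! ### Flat connections of Darboux frames; gluing of connections and trace forms. -/

section
variable {n : ℕ} {M σ : Type*} [TopologicalSpace M]
  [ChartedSpace (EuclideanSpace ℝ (Fin (2 * n))) M] [IsManifold (𝓡 (2 * n)) (⊤ : ℕ∞) M]
  [T2Space M] {ω : TwoTensor (Scalars σ) (Fn n M σ)} {P : Submodule (Fn n M σ) (VF n M σ)}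
  {V : Set M}

namespace DarbouxFrame

/-- The covariant derivative for which the vector fields of the frame are parallel. -/
def flatDeriv (B : DarbouxFrame ω P V) (X Y : VF n M σ) : VF n M σ :=
  ∑ i, X (Y (B.x i)) • B.ex i + ∑ i, X (Y (B.y i)) • B.ey i

omit [IsManifold (𝓡 (2 * n)) (⊤ : ℕ∞) M] [T2Space M]

theorem ev_flatDeriv (B : DarbouxFrame ω P V) (X Y : VF n M σ) (q : M) (f : Fn n M σ) :
    ev q (B.flatDeriv X Y f) = ∑ i, ev q (X (Y (B.x i))) * ev q (B.ex i f) +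
      ∑ i, ev q (X (Y (B.y i))) * ev q (B.ey i f) := by
  rw [flatDeriv, Derivation.add_apply, map_add, ev_sum_smul_apply, ev_sum_smul_apply]

theorem flatDeriv_add_left (B : DarbouxFrame ω P V) (X X' Y : VF n M σ) :
    B.flatDeriv (X + X') Y = B.flatDeriv X Y + B.flatDeriv X' Y := by
  simp only [flatDeriv, Derivation.add_apply, add_smul, Finset.sum_add_distrib]
  abel

theorem flatDeriv_smul_left (B : DarbouxFrame ω P V) (f : Fn n M σ) (X Y : VF n M σ) :
    B.flatDeriv (f • X) Y = f • B.flatDeriv X Y := by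
  simp only [flatDeriv, Derivation.smul_apply, smul_add, Finset.smul_sum, smul_assoc]

theorem flatDeriv_add_right (B : DarbouxFrame ω P V) (X Y Y' : VF n M σ) :
    B.flatDeriv X (Y + Y') = B.flatDeriv X Y + B.flatDeriv X Y' := by
  simp only [flatDeriv, Derivation.add_apply, map_add, add_smul, Finset.sum_add_distrib]
  abel

theorem flatDeriv_smul_right (B : DarbouxFrame ω P V) (c : Scalars σ) (X Y : VF n M σ) :
    B.flatDeriv X (c • Y) = c • B.flatDeriv X Y := by
  simp only [flatDeriv, Derivation.smul_apply, Derivation.map_smul, smul_add, Finset.smul_sum,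
    smul_assoc]

theorem flatDeriv_leibniz (B : DarbouxFrame ω P V) (f : Fn n M σ) (X Y : VF n M σ) {q : M}
    (hq : q ∈ V) : VEq q (B.flatDeriv X (f • Y)) (X f • Y + f • B.flatDeriv X Y) := by
  intro g
  rw [ev_flatDeriv, Derivation.add_apply, map_add, Derivation.smul_apply, Derivation.smul_apply,
    smul_eq_mul, smul_eq_mul, map_mul, map_mul, ev_flatDeriv, B.expand q hq Y g]
  simp only [Derivation.smul_apply, Derivation.leibniz, smul_eq_mul, map_add, map_mul, add_mul,
    Finset.sum_add_distrib, mul_add, Finset.mul_sum]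
  simp only [mul_assoc, mul_left_comm (ev q (Y _)) (ev q (X f))]
  abel

theorem flatDeriv_torsionFree (B : DarbouxFrame ω P V) (X Y : VF n M σ) {q : M} (hq : q ∈ V) :
    VEq q (B.flatDeriv X Y - B.flatDeriv Y X) ⁅X, Y⁆ := by
  intro f
  rw [Derivation.sub_apply, map_sub, ev_flatDeriv, ev_flatDeriv, B.expand q hq ⁅X, Y⁆ f]
  simp only [Derivation.commutator_apply, map_sub, sub_mul, Finset.sum_sub_distrib]
  ring

theorem ev_flatDeriv_x (B : DarbouxFrame ω P V) (X Y : VF n M σ) {q : M} (hq : q ∈ V)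
    (i : Fin n) : ev q (B.flatDeriv X Y (B.x i)) = ev q (X (Y (B.x i))) := by
  rw [ev_flatDeriv]
  simp [B.ex_x q hq, B.ey_x q hq]

theorem ev_flatDeriv_y (B : DarbouxFrame ω P V) (X Y : VF n M σ) {q : M} (hq : q ∈ V)
    (i : Fin n) : ev q (B.flatDeriv X Y (B.y i)) = ev q (X (Y (B.y i))) := by
  rw [ev_flatDeriv]
  simp [B.ex_y q hq, B.ey_y q hq]

/-- The value at a point of a contraction of `ω`, in Darboux coordinates. -/
theorem ev_omega (B : DarbouxFrame ω P V) (X Y : VF n M σ) {q : M} (hq : q ∈ V) :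
    ev q (ω X Y) = ev q (∑ i, (Y (B.x i) * X (B.y i) - Y (B.y i) * X (B.x i))) := by
  rw [B.omega q hq, map_sum]
  refine Finset.sum_congr rfl fun i _ => ?_
  rw [map_sub, map_mul, map_mul]
  ring

/-- Bilinearity of ω alone does not move it past a gluing, which is only a locally finite sum. The
Darboux expression does, because it involves only the values of the field on the finitely many
coordinates. -/
theorem ev_omega_glueField {ι : Type*} (B : DarbouxFrame ω P V)
    (ρ : SmoothPartitionOfUnity ι (𝓡 (2 * n)) M Set.univ) (X : ι → VF n M σ) (Y : VF n M σ)
    {q : M} (hq : q ∈ V) : ev q (ω (glueField ρ X) Y) = ev q (glue ρ fun j => ω (X j) Y) := by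
  rw [ev_glue_congr ρ (g' := ∑ i, ((Y (B.x i)) • (fun j => X j (B.y i)) -
    (Y (B.y i)) • fun j => X j (B.x i))), B.ev_omega _ _ hq]
  · simp only [map_sum, map_sub, map_smul, smul_eq_mul, glueField_apply]
  · intro j _
    rw [B.ev_omega _ _ hq, Finset.sum_apply]
    rfl

variable [IsManifold (𝓡 (2 * n)) (⊤ : ℕ∞) M] [T2Space M]

/-- In Darboux coordinates ω has constant coefficients, so this is the product rule. The last term
has its arguments exchanged so that the derived field is always in the first slot, as
`ev_omega_glueField` needs. -/
theorem flatDeriv_symplectic (B : DarbouxFrame ω P V) (X Y Z : VF n M σ) {q : M} (hq : q ∈ V) :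
    ev q (X (ω Y Z)) = ev q (ω (B.flatDeriv X Y) Z) - ev q (ω (B.flatDeriv X Z) Y) := by
  rw [ev_derivation_congr X (g := ∑ i, (Z (B.x i) * Y (B.y i) - Z (B.y i) * Y (B.x i)))
    (by filter_upwards [B.isOpen.mem_nhds hq] with r hr using B.ev_omega Y Z hr),
    B.omega q hq, B.omega q hq, map_sum, map_sum, ← Finset.sum_sub_distrib]
  refine Finset.sum_congr rfl fun i _ => ?_
  simp only [B.ev_flatDeriv_x _ _ hq, B.ev_flatDeriv_y _ _ hq, map_sub, Derivation.leibniz,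
    smul_eq_mul, map_add, map_mul]
  ring

/-- The x-components of Y vanish near `q`, so those of its flat derivative do too and only `ey`
terms remain. These lie in P and are killed by the x-coordinates of any other frame, so averages
over different frames stay in P. -/
theorem ev_flatDeriv_x_of_mem {V' : Set M} (B : DarbouxFrame ω P V) (B' : DarbouxFrame ω P V')
    (X : VF n M σ) {Y : VF n M σ} (hY : Y ∈ P) {q : M} (hq : q ∈ V) (hq' : q ∈ V') (i : Fin n) :
    ev q (B.flatDeriv X Y (B'.x i)) = 0 := by
  rw [ev_flatDeriv]
  have h : ∀ j, ev q (X (Y (B.x j))) = 0 := fun j =>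
    ev_derivation_of_eventually_eq_const X
      (by filter_upwards [B.isOpen.mem_nhds hq] with r hr using B.apply_x hY hr j)
  simp [h, B'.apply_x (B.ey_mem _) hq']

end DarbouxFrame

/-- The connection glued from the flat connections of Darboux frames. -/
def gluedConnection {ι : Type*} {V : ι → Set M} (B : ∀ j, DarbouxFrame ω P (V j))
    (ρ : SmoothPartitionOfUnity ι (𝓡 (2 * n)) M Set.univ) (hρ : ∀ j q, ρ j q ≠ 0 → q ∈ V j) :
    Connection (Scalars σ) (Fn n M σ) where
  toFun X Y := glueField ρ fun j => (B j).flatDeriv X Y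
  add_left X X' Y := by
    rw [← map_add]
    exact congrArg _ (funext fun j => (B j).flatDeriv_add_left X X' Y)
  smul_left f X Y := by
    rw [← map_smul]
    exact congrArg _ (funext fun j => (B j).flatDeriv_smul_left f X Y)
  add_right X Y Y' := by
    rw [← map_add]
    exact congrArg _ (funext fun j => (B j).flatDeriv_add_right X Y Y')
  smul_right c X Y := by
    rw [← algebraMap_smul (Fn n M σ) c (glueField ρ _), ← map_smul]
    refine congrArg _ (funext fun j => ?_)
    rw [Pi.smul_apply, algebraMap_smul]
    exact (B j).flatDeriv_smul_right c X Y
  leibniz f X Y := by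
    -- The term X(f) Y carries no connection, so it is reproduced exactly only because the weights
    -- sum to 1.
    rw [← glueField_const ρ (X f • Y), ← map_smul, ← map_add]
    exact glueField_congr ρ fun j q hj => (B j).flatDeriv_leibniz f X Y (hρ j q hj)

theorem isPSymplectic_gluedConnection (hP : IsPolarizedSymplectic ω P) {V : M → Set M}
    (B : ∀ j, DarbouxFrame ω P (V j)) (ρ : SmoothPartitionOfUnity M (𝓡 (2 * n)) M Set.univ)
    (hV : ∀ p, p ∈ V p) (hρ : ∀ j q, ρ j q ≠ 0 → q ∈ V j) :
    IsPSymplectic ω P (gluedConnection B ρ hρ) := by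
  have ht : ∀ X Y : VF n M σ, (gluedConnection B ρ hρ).toFun X Y -
      (gluedConnection B ρ hρ).toFun Y X = ⁅X, Y⁆ := by
    intro X Y
    rw [← glueField_const ρ ⁅X, Y⁆]
    refine ((glueField ρ).map_sub _ _).symm.trans ?_
    exact glueField_congr ρ fun j q hj => (B j).flatDeriv_torsionFree X Y (hρ j q hj)
  have hs : ∀ X Y Z : VF n M σ, X (ω Y Z) = ω ((gluedConnection B ρ hρ).toFun X Y) Z +
      ω Y ((gluedConnection B ρ hρ).toFun X Z) := by
    intro X Y Z
    refine Fn.ext_ev fun q => ?_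
    rw [← hP.alt.neg_eq ((gluedConnection B ρ hρ).toFun X Z) Y, ← sub_eq_add_neg, map_sub]
    change _ = ev q (ω (glueField ρ _) Z) - ev q (ω (glueField ρ _) Y)
    rw [(B q).ev_omega_glueField ρ _ _ (hV q), (B q).ev_omega_glueField ρ _ _ (hV q), ← map_sub,
      ← map_sub]
    refine (ev_glue_eq ρ fun j hj => ?_).symm
    rw [(B j).flatDeriv_symplectic X Y Z (hρ j q hj)]
    exact map_sub (ev q) _ _
  have hp : (gluedConnection B ρ hρ).Preserves P := by
    intro X Y hY
    refine hP.sheaf _ fun q => ((B q).mem_iff q (hV q) _).2 ?_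
    filter_upwards [(B q).isOpen.mem_nhds (hV q)] with r hr i
    exact ev_glue_eq ρ fun j hj => (B j).ev_flatDeriv_x_of_mem (B q) X hY (hρ j r hj) hr i
  refine ⟨ht, hs, hp, fun X hX Y hY Z hZ => Derivation.ext fun f => Fn.ext_ev fun q => ?_⟩
  exact (B q).curvature_veq_zero ht hs hp hX hY hZ (hV q) f

theorem DarbouxFrame.fibreCurvatureTrace_eq (B : DarbouxFrame ω P V)
    {D : Connection (Scalars σ) (Fn n M σ)} (hp : D.Preserves P) (X Y : VF n M σ) {q : M}
    (hq : q ∈ V) : D.fibreCurvatureTrace hp X Y (vanishingIdeal q) =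
      ev q (extDerivOne (B.connectionTrace D) X Y) := by
  rw [B.ev_extDerivOne_connectionTrace hp X Y hq]
  exact B.trace_fibre hq _

/-- Two-tensors glued by means of a partition of unity. -/
def glueTensor {ι : Type*} (ρ : SmoothPartitionOfUnity ι (𝓡 (2 * n)) M Set.univ)
    (β : ι → TwoTensor (Scalars σ) (Fn n M σ)) : TwoTensor (Scalars σ) (Fn n M σ) :=
  LinearMap.mk₂ _ (fun X Y => glue ρ fun j => β j X Y)
    (fun X X' Y => by
      rw [← map_add]
      exact congrArg _ (funext fun j => by rw [map_add]; rfl))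
    (fun f X Y => by
      rw [← map_smul]
      exact congrArg _ (funext fun j => by rw [map_smul]; rfl))
    (fun X Y Y' => by
      rw [← map_add]
      exact congrArg _ (funext fun j => by rw [map_add]; rfl))
    (fun f X Y => by
      rw [← map_smul]
      exact congrArg _ (funext fun j => by rw [map_smul]; rfl))

/-- One-forms glued by means of a partition of unity. -/
def glueForm {ι : Type*} (ρ : SmoothPartitionOfUnity ι (𝓡 (2 * n)) M Set.univ)
    (η : ι → OneForm (Scalars σ) (Fn n M σ)) : OneForm (Scalars σ) (Fn n M σ) :=
  glue ρ ∘ₗ LinearMap.pi η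

theorem extDerivOne_apply {K F : Type*} [CommRing K] [CommRing F] [Algebra K F] (η : OneForm K F)
    (X Y : Derivation K F F) : extDerivOne η X Y = X (η Y) - Y (η X) - η ⁅X, Y⁆ := rfl

theorem ev_extDerivOne_congr {η η' : OneForm (Scalars σ) (Fn n M σ)} {q : M}
    (h : ∀ᶠ r in 𝓝 q, ∀ X : VF n M σ, ev r (η X) = ev r (η' X)) (X Y : VF n M σ) :
    ev q (extDerivOne η X Y) = ev q (extDerivOne η' X Y) := by
  rw [extDerivOne_apply, extDerivOne_apply, map_sub, map_sub, map_sub, map_sub,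
    ev_derivation_congr X (h.mono fun r hr => hr Y), ev_derivation_congr Y (h.mono fun r hr => hr X),
    h.self_of_nhds]

theorem extDerivOne_sub {K F : Type*} [CommRing K] [CommRing F] [Algebra K F] (η η' : OneForm K F)
    (X Y : Derivation K F F) :
    extDerivOne (η - η') X Y = extDerivOne η X Y - extDerivOne η' X Y := by
  simp only [extDerivOne_apply, LinearMap.sub_apply, map_sub]
  ring

/-- The difference of two connections that preserve `P`, as an endomorphism of `P`. -/
def Connection.differenceOn {K F : Type*} [CommRing K] [CommRing F] [Algebra K F]
    {P : Submodule F (Derivation K F F)} {D D' : Connection K F} (h : D.Preserves P)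
    (h' : D'.Preserves P) (X : Derivation K F F) : P →ₗ[F] P where
  toFun Z := ⟨D'.toFun X Z - D.toFun X Z, P.sub_mem (h' X _ Z.2) (h X _ Z.2)⟩
  map_add' Z W := Subtype.ext (by
    simp only [Submodule.coe_add, D.add_right, D'.add_right]
    abel)
  map_smul' f Z := Subtype.ext (by
    simp only [Submodule.coe_smul, D.leibniz, D'.leibniz, RingHom.id_apply]
    module)

/-- The left side mentions no frame, so the local forms on the right agree on overlaps. -/
theorem DarbouxFrame.trace_differenceOn (B : DarbouxFrame ω P V)
    {D D' : Connection (Scalars σ) (Fn n M σ)} (h : D.Preserves P) (h' : D'.Preserves P)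
    (X : VF n M σ) {q : M} (hq : q ∈ V) :
    LinearMap.trace (Scalars σ) (Fibre P (vanishingIdeal q))
      (LinearMap.restrictScalars (Scalars σ) (Submodule.mapQ _ _ (Connection.differenceOn h h' X)
        (Submodule.smul_top_le_comap_smul_top (vanishingIdeal q)
          (Connection.differenceOn h h' X)))) =
      ev q ((B.connectionTrace D' - B.connectionTrace D) X) := by
  rw [B.trace_fibre hq, LinearMap.sub_apply, connectionTrace_apply, connectionTrace_apply,
    ← Finset.sum_sub_distrib, map_sum]
  rfl

end

/-! ### The three assertions. -/

theorem IsPolarizedSymplectic.exists_isPSymplectic {n : ℕ} {M σ : Type*} [TopologicalSpace M]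
    [T2Space M] [SigmaCompactSpace M] [ChartedSpace (EuclideanSpace ℝ (Fin (2 * n))) M]
    [IsManifold (𝓡 (2 * n)) (⊤ : ℕ∞) M] {ω : TwoTensor (Scalars σ) (Fn n M σ)}
    {P : Submodule (Fn n M σ) (VF n M σ)} (hP : IsPolarizedSymplectic ω P) :
    ∃ D : Connection (Scalars σ) (Fn n M σ), IsPSymplectic ω P D := by
  obtain ⟨V, B, ρ, hV, hρ⟩ := hP.exists_atlas
  exact ⟨_, isPSymplectic_gluedConnection hP B ρ hV hρ⟩

theorem IsPolarizedSymplectic.exists_isCurvatureTrace {n : ℕ} {M σ : Type*} [TopologicalSpace M]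
    [T2Space M] [SigmaCompactSpace M] [ChartedSpace (EuclideanSpace ℝ (Fin (2 * n))) M]
    [IsManifold (𝓡 (2 * n)) (⊤ : ℕ∞) M] {ω : TwoTensor (Scalars σ) (Fn n M σ)}
    {P : Submodule (Fn n M σ) (VF n M σ)} (hP : IsPolarizedSymplectic ω P)
    {D : Connection (Scalars σ) (Fn n M σ)} (h : IsPSymplectic ω P D) :
    ∃ β ∈ sectionsDPerp P, IsCurvatureTrace D h.preserves β := by
  obtain ⟨V, B, ρ, hV, hρ⟩ := hP.exists_atlas
  let β : TwoTensor (Scalars σ) (Fn n M σ) :=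
    glueTensor ρ fun p => extDerivOne ((B p).connectionTrace D)
  -- All the local forms dθ contributing at `q` have the same value there, the fibre trace, so the
  -- weighted sum returns it.
  have hβ : IsCurvatureTrace D h.preserves β := fun X Y q =>
    ev_glue_eq ρ fun j hj => ((B j).fibreCurvatureTrace_eq h.preserves X Y (hρ j q hj)).symm
  refine ⟨β, fun p => ?_, hβ⟩
  obtain ⟨χ, hχ1, hχ0⟩ := exists_cutoff (σ := σ) (n := n) (B p).isOpen (hV p)
  -- The trace form kills P only over `V p`. Multiplying by χ makes it a global section of P^⊥
  -- without changing its germ at `p`, hence without changing its differential nearby.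
  refine ⟨χ • (B p).connectionTrace D, ?_, ?_⟩
  · intro X hX
    refine Fn.ext_ev fun q => ?_
    rw [LinearMap.smul_apply, smul_eq_mul, map_mul, map_zero]
    by_cases hq : q ∈ V p
    · rw [(B p).ev_connectionTrace_of_mem h hX hq, mul_zero]
    · rw [(hχ0 q hq).self_of_nhds, zero_mul]
  · filter_upwards [(B p).isOpen.mem_nhds (hV p), eventually_eventually_nhds.2 hχ1] with q hq h1 X Y
    rw [hβ X Y q, (B p).fibreCurvatureTrace_eq h.preserves X Y hq]
    refine ev_extDerivOne_congr ?_ X Y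
    filter_upwards [h1] with r hr Z
    rw [LinearMap.smul_apply, smul_eq_mul, map_mul, hr, one_mul]

theorem IsPolarizedSymplectic.sub_mem_exactPerp {n : ℕ} {M σ : Type*} [TopologicalSpace M]
    [T2Space M] [SigmaCompactSpace M] [ChartedSpace (EuclideanSpace ℝ (Fin (2 * n))) M]
    [IsManifold (𝓡 (2 * n)) (⊤ : ℕ∞) M] {ω : TwoTensor (Scalars σ) (Fn n M σ)}
    {P : Submodule (Fn n M σ) (VF n M σ)} (hP : IsPolarizedSymplectic ω P)
    {D D' : Connection (Scalars σ) (Fn n M σ)} (h : IsPSymplectic ω P D)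
    (h' : IsPSymplectic ω P D') {β β' : TwoTensor (Scalars σ) (Fn n M σ)}
    (hβ : IsCurvatureTrace D h.preserves β) (hβ' : IsCurvatureTrace D' h'.preserves β') :
    β' - β ∈ exactPerp P := by
  obtain ⟨V, B, ρ, hV, hρ⟩ := hP.exists_atlas
  let θ : OneForm (Scalars σ) (Fn n M σ) :=
    glueForm ρ fun p => (B p).connectionTrace D' - (B p).connectionTrace D
  -- By frame independence, gluing changes nothing: on each `V p` the global form θ is the local
  -- difference itself, so no derivatives of the weights enter dθ.
  have hθ : ∀ p, ∀ q ∈ V p, ∀ X,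
      ev q (θ X) = ev q (((B p).connectionTrace D' - (B p).connectionTrace D) X) := by
    intro p q hq X
    refine ev_glue_eq ρ fun j hj => ?_
    change ev q (((B j).connectionTrace D' - (B j).connectionTrace D) X) = _
    rw [← (B j).trace_differenceOn h.preserves h'.preserves X (hρ j q hj),
      (B p).trace_differenceOn h.preserves h'.preserves X hq]
  refine ⟨θ, fun X hX => Fn.ext_ev fun q => ?_, ?_⟩
  · rw [hθ q q (hV q), LinearMap.sub_apply, map_sub, (B q).ev_connectionTrace_of_mem h hX (hV q),
      (B q).ev_connectionTrace_of_mem h' hX (hV q), sub_zero, map_zero]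
  · refine LinearMap.ext₂ fun X Y => Fn.ext_ev fun q => ?_
    rw [ev_extDerivOne_congr (η' := (B q).connectionTrace D' - (B q).connectionTrace D)
      (by filter_upwards [(B q).isOpen.mem_nhds (hV q)] with r hr using hθ q r hr),
      extDerivOne_sub, map_sub, ← (B q).fibreCurvatureTrace_eq h.preserves X Y (hV q),
      ← (B q).fibreCurvatureTrace_eq h'.preserves X Y (hV q), ← hβ X Y q, ← hβ' X Y q]
    exact (map_sub (ev q) _ _).symm

end FormalPSM
end

theorem mainTheorem7 (n : ℕ) (M : Type*) [TopologicalSpace M] [T2Space M]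
    [SigmaCompactSpace M] [ChartedSpace (EuclideanSpace ℝ (Fin (2 * n))) M]
    [IsManifold (𝓡 (2 * n)) (⊤ : ℕ∞) M] (σ : Type*) [Subsingleton σ]
    (ω : FormalPSM.TwoTensor (FormalPSM.Scalars σ) (FormalPSM.Fn n M σ))
    (P : Submodule (FormalPSM.Fn n M σ) (FormalPSM.VF n M σ))
    (hP : FormalPSM.IsPolarizedSymplectic ω P) :
    (∃ D : FormalPSM.Connection (FormalPSM.Scalars σ) (FormalPSM.Fn n M σ),
      FormalPSM.IsPSymplectic ω P D) ∧
    (∀ (D : FormalPSM.Connection (FormalPSM.Scalars σ) (FormalPSM.Fn n M σ))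
      (h : FormalPSM.IsPSymplectic ω P D),
      ∃ β ∈ FormalPSM.sectionsDPerp P, FormalPSM.IsCurvatureTrace D h.preserves β) ∧
    (∀ (D D' : FormalPSM.Connection (FormalPSM.Scalars σ) (FormalPSM.Fn n M σ))
      (h : FormalPSM.IsPSymplectic ω P D) (h' : FormalPSM.IsPSymplectic ω P D')
      (β β' : FormalPSM.TwoTensor (FormalPSM.Scalars σ) (FormalPSM.Fn n M σ)),
      FormalPSM.IsCurvatureTrace D h.preserves β →
      FormalPSM.IsCurvatureTrace D' h'.preserves β' →
        β' - β ∈ FormalPSM.exactPerp P) :=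
  ⟨hP.exists_isPSymplectic, fun _ h => hP.exists_isCurvatureTrace h,
    fun _ _ h h' _ _ hβ hβ' => hP.sub_mem_exactPerp h h' hβ hβ'⟩
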